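/- Let $V$ be a finite set with $|V|=n+1$, and let $T=\{\lambda\in\mathbb R_{\ge 0}^V:\sum_{i}\lambda_i=1\}$, with an orientation (an ordering modulo even permutations) fixed on $T$ and on each face $T_W=\{\lambda\in\mathbb R^W_{\ge0}:\sum_{i\in W}\lambda_i=1\}$, $W\subseteq V$. A flag $F=(V_0,\dots,V_{n-k})$ is an ordered partition of $V$ into nonempty blocks. Put $R=\{r\in\mathbb R_{\ge0}^{n-k+1}:\sum_j r_j=1\}$ and $\Theta=\prod_j T_{V_j}$. The map $\Phi(\rho,\theta)=\lambda$, $\lambda_i=\rho_j\theta_i$ for $i\in V_j$, is a diffeomorphism of $\mathring R\times\mathring\Theta$ onto $\mathring T$, with $\rho_j=\sum_{i\in V_j}\lambda_i$ and $\theta_i=\lambda_i/\rho_j$; give $\Theta$ the product orientation and $R$ the orientation for which $\Phi$ preserves orientation. Let $\omega$ be the constant multiple of the volume form of $T$ with $\int_T\omega=1$. For $\rho\in\mathring R$ let $R_\rho=\{r\in R: r_{j}/\rho_{j}\le r_{j'}/\rho_{j'}\text{ for } j\le j'\}$. The fibre integral $\psi_{F,\rho}=\int_{R_\rho}\Phi^*\omega$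 (the $R$ directions occupying the first slots) is a $k$-form on $\Theta$. The blow-up Whitney form $\psi_F$ is the $k$-form on $\mathring T$ given at $x=\Phi(\rho,\theta)$ by $\psi_F(X_1,\dots,X_k)=\psi_{F,\rho}(Y_1,\dots,Y_k)$, where $Y_i$ is the projection of $X_i$ to the $\Theta$ factor. Theorem. Every $\psi_F$ is smooth on $\mathring T$, and for every flag $F=(V_0,\dots,V_{n-k})$ there are signs $\varepsilon_j\in\{1,-1\}$, constant on $\mathring T$, with $$d\psi_F=\sum_{j=1}^{n-k}\varepsilon_j\,\psi_{F_j},$$ where $F_j$ is the flag obtained from $F$ by replacing the two consecutive blocks $V_{j-1}$ and $V_j$ with their union; in particular $d\psi_F=0$ if $F=(V)$. Without changing the orientations of the blocks of $F$, the orientations of the other faces can be chosen so that $d\psi_F=\sum_{j=1}^{n-k}\psi_{F_j}$. Consequently, if $B^k$ denotes the linear span of the forms $\psi_F$ over all flags $F$ with $n-k+1$ blocks, then $d$ restricts to linear maps $B^k\to B^{k+1}$ with $d\circ d=0$, so that the blow-up Whitney forms are a complex. -/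

import Mathlib

open scoped ContDiff

namespace BlowUp

noncomputable section

/-- A flag on `V` with `p + 1` blocks: an ordered partition `(V_0, …, V_p)` of `V` into nonempty
sets, encoded by the surjective map that sends a vertex to the index of its block. -/
structure SimplexFlag (V : Type*) (p : ℕ) where
  blk : V → Fin (p + 1)
  surj : Function.Surjective blk

/-- The vectors of `ℝ^V` tangent to the standard simplex. -/
def tangentSpace (V : Type*) [Fintype V] : Submodule ℝ (V → ℝ) where
  carrier := {v | ∑ i, v i = 0}
  add_mem' := by
    intro a b ha hb
    simp only [Set.mem_ofPred_eq, Pi.add_apply, Finset.sum_add_distrib] at *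
    rw [ha, hb, add_zero]
  zero_mem' := by simp
  smul_mem' := by
    intro c a ha
    simp only [Set.mem_ofPred_eq, Pi.smul_apply, smul_eq_mul] at *
    rw [← Finset.mul_sum, ha, mul_zero]

/-- The interior of the standard barycentric coordinate simplex `T_V`. -/
def simplexInterior (V : Type*) [Fintype V] : Set (V → ℝ) :=
  {x | (∀ i, 0 < x i) ∧ ∑ i, x i = 1}

/-- Differential `k`-forms (with no regularity) on the interior of `T_V`. -/
abbrev SimplexForm (V : Type*) [Fintype V] (k : ℕ) : Type _ :=
  simplexInterior V → (tangentSpace V) [⋀^Fin k]→L[ℝ] ℝ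

open Classical in
/-- The form `α` read in the affine chart `v ↦ x + v` of the simplex centred at `x`
(it is extended by zero outside of the simplex). -/
def SimplexForm.inChart {V : Type*} [Fintype V] {k : ℕ} (α : SimplexForm V k) (x : V → ℝ)
    (v : tangentSpace V) : (tangentSpace V) [⋀^Fin k]→L[ℝ] ℝ :=
  if h : x + (v : V → ℝ) ∈ simplexInterior V then α ⟨x + (v : V → ℝ), h⟩ else 0

/-- Smoothness on the interior of the simplex. -/
def SimplexForm.Smooth {V : Type*} [Fintype V] {k : ℕ} (α : SimplexForm V k) : Prop :=
  ∀ x : simplexInterior V, ContDiffAt ℝ ∞ (α.inChart x) 0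

/-- The exterior derivative on the interior of the simplex; at `x` it is computed in the affine
chart centred at `x`. -/
def SimplexForm.d {V : Type*} [Fintype V] {k : ℕ} (α : SimplexForm V k) : SimplexForm V (k + 1) :=
  fun x => extDeriv (α.inChart x) 0

/-- A choice of an orientation of every face `T_W` of the simplex; each orientation is given by an
ordering of `W` that represents it. -/
abbrev FaceOrientation (V : Type*) : Type _ := ∀ W : Finset V, Fin W.card ≃ W

/-- Contraction of a form with `v 0, …, v (p - 1)` in its first `p` slots:
`(contract p η v) (w) = η (v 0, …, v (p - 1), w 0, …, w (k - 1))`. -/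
def contract {E : Type*} [NormedAddCommGroup E] [NormedSpace ℝ E] {k : ℕ} :
    (p : ℕ) → E [⋀^Fin (k + p)]→L[ℝ] ℝ → (Fin p → E) → E [⋀^Fin k]→L[ℝ] ℝ
  | 0, η, _ => η
  | p + 1, η, v => contract p (ContinuousAlternatingMap.curryLeft (n := k + p) η (v 0))
      (fun l => v l.succ)

section Forms

variable {V : Type*} [Fintype V]

/-- The form `dλ_W = ⋀_{i ∈ W} dλ_i` on `ℝ^V`, in the order given by the orientation. -/
def dLambda (o : FaceOrientation V) (W : Finset V) {N : ℕ} (h : W.card = N) :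
    (V → ℝ) [⋀^Fin N]→L[ℝ] ℝ where
  __ := (Matrix.detRowAlternating (R := ℝ) (n := Fin N)).compLinearMap
    (LinearMap.pi fun b => LinearMap.proj (R := ℝ) (φ := fun _ : V => ℝ)
      (o W (Fin.cast h.symm b) : V))
  cont := by
    change Continuous fun v : Fin N → V → ℝ =>
      Matrix.det (Matrix.of fun a b => v a (o W (Fin.cast h.symm b) : V))
    fun_prop

/-- The Whitney form `φ_V = n! i_X dλ_V`, where `X` is the tautological vector field and
`n + 1 = |V|`. Restricted to `T_V`, it is the constant multiple `ω` of the volume form for which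
`∫_{T_V} ω = 1`. -/
def whitneyForm (o : FaceOrientation V) {n : ℕ} (h : Fintype.card V = n + 1) (x : V → ℝ) :
    (V → ℝ) [⋀^Fin n]→L[ℝ] ℝ :=
  (n.factorial : ℝ) • (dLambda o Finset.univ h).curryLeft x

end Forms

namespace SimplexFlag

variable {V : Type*} {p : ℕ}

/-- The flag obtained by replacing the consecutive blocks `V_j` and `V_{j+1}` by their union. -/
def merge {q : ℕ} (F : SimplexFlag V (q + 1)) (j : Fin (q + 1)) : SimplexFlag V q where
  blk := fun i => j.predAbove (F.blk i)
  surj := (Fin.predAbove_surjective j).comp F.surj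

/-- The quasi-cylindrical coordinate map `Φ(r, θ) = (r_j θ_i)_{i ∈ V_j}`. -/
def cyl (F : SimplexFlag V p) (q : (Fin (p + 1) → ℝ) × (V → ℝ)) : V → ℝ :=
  fun i => q.1 (F.blk i) * q.2 i

variable [Fintype V]

/-- The block `V_j`. -/
def block (F : SimplexFlag V p) (j : Fin (p + 1)) : Finset V :=
  Finset.univ.filter fun i => F.blk i = j

/-- `ρ_j = ∑_{i ∈ V_j} λ_i`. -/
def rho (F : SimplexFlag V p) (x : V → ℝ) (j : Fin (p + 1)) : ℝ := ∑ i ∈ F.block j, x i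

/-- The projection to the angular space, `θ_i = λ_i / ρ_j` for `i ∈ V_j`. -/
def theta (F : SimplexFlag V p) (x : V → ℝ) : V → ℝ := fun i => x i / F.rho x (F.blk i)

theorem block_card_pos (F : SimplexFlag V p) (j : Fin (p + 1)) : 0 < (F.block j).card := by
  obtain ⟨i, hi⟩ := F.surj j
  exact Finset.card_pos.mpr ⟨i, by simp [block, hi]⟩

theorem sum_dim (F : SimplexFlag V p) {k : ℕ} (h : Fintype.card V = k + p + 1) :
    k = ∑ j, ((F.block j).card - 1) := by
  have h1 : Fintype.card V = ∑ j, (F.block j).card := by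
    rw [← Finset.card_univ]
    exact Finset.card_eq_sum_card_fiberwise (fun i _ => Finset.mem_coe.mpr (Finset.mem_univ _))
  have h2 : ∑ j, (F.block j).card = ∑ j, (((F.block j).card - 1) + 1) :=
    Finset.sum_congr rfl fun j _ => by have := F.block_card_pos j; omega
  rw [Finset.sum_add_distrib] at h2
  simp only [Finset.sum_const, Finset.card_univ, Fintype.card_fin, smul_eq_mul, mul_one] at h2
  omega

/-- A positively oriented frame of the angular space `Θ = T_{V_0} × … × T_{V_p}`: the positive
frames `(e_{i_1} - e_{i_0}, …, e_{i_m} - e_{i_0})` of the factors `T_{V_j}`, where `(i_0, …, i_m)`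
is the ordering of `V_j`, one after the other. -/
def thetaFrame [DecidableEq V] (o : FaceOrientation V) (F : SimplexFlag V p) {k : ℕ}
    (h : Fintype.card V = k + p + 1) (a : Fin k) : V → ℝ :=
  let b := finSigmaFinEquiv.symm (Fin.cast (F.sum_dim h) a)
  Pi.single (o (F.block b.1) ⟨b.2 + 1, by have := b.2.isLt; omega⟩ : V) 1
    - Pi.single (o (F.block b.1) ⟨0, F.block_card_pos b.1⟩ : V) 1

/-- The frame `∂_l = e_l - e_0` (`1 ≤ l ≤ p`) of the radial simplex `R`, as a tuple of vectors
tangent to the first factor of `R × Θ`. -/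
def radialFrame (V : Type*) (p : ℕ) (l : Fin p) : (Fin (p + 1) → ℝ) × (V → ℝ) :=
  (Pi.single l.succ 1 - Pi.single 0 1, 0)

/-- The pullback `Φ^* ω` to `R × Θ` at `(r, θ)`, contracted with the frame `∂_1, …, ∂_p` of `R` (in
the first slots), as an alternating form on the second factor. -/
def fiberForm (o : FaceOrientation V) (F : SimplexFlag V p) {k : ℕ}
    (h : Fintype.card V = k + p + 1) (r : Fin (p + 1) → ℝ) (θ : V → ℝ) :
    (V → ℝ) [⋀^Fin k]→L[ℝ] ℝ :=
  (contract p ((whitneyForm o h (F.cyl (r, θ))).compContinuousLinearMap (fderiv ℝ F.cyl (r, θ)))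
    (radialFrame V p)).compContinuousLinearMap
      (ContinuousLinearMap.inr ℝ (Fin (p + 1) → ℝ) (V → ℝ))

/-- The orientation of `R` for which `Φ : R × Θ → T` preserves orientation: the sign is `1` if the
frame `∂_1, …, ∂_p` is positive, and `-1` otherwise. It is read off at the barycentres of `R` and
`Θ`. -/
def radialSign [DecidableEq V] (o : FaceOrientation V) (F : SimplexFlag V p) {k : ℕ}
    (h : Fintype.card V = k + p + 1) : ℝ :=
  Real.sign (F.fiberForm o h (fun _ => ((p : ℝ) + 1)⁻¹) (F.theta fun _ => 1) (F.thetaFrame o h))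

/-- The subset `R_ρ` of the radial simplex `R`. -/
def region (ρ : Fin (p + 1) → ℝ) : Set (Fin (p + 1) → ℝ) :=
  {r | (∀ j, 0 ≤ r j) ∧ ∑ j, r j = 1 ∧ ∀ j j', j ≤ j' → r j / ρ j ≤ r j' / ρ j'}

/-- The parametrization of the affine hull of `R` by the coordinates `r_1, …, r_p`; the coordinate
fields are `∂_1, …, ∂_p`. -/
def radialPoint (s : Fin p → ℝ) : Fin (p + 1) → ℝ := Fin.cons (1 - ∑ l, s l) s

/-- The form `ψ_{F,ρ} = ∫_{R_ρ} ω` on the angular space `Θ`, at the point `θ`. -/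
def angularForm [DecidableEq V] (o : FaceOrientation V) (F : SimplexFlag V p) {k : ℕ}
    (h : Fintype.card V = k + p + 1) (ρ : Fin (p + 1) → ℝ) (θ : V → ℝ) :
    (V → ℝ) [⋀^Fin k]→L[ℝ] ℝ :=
  F.radialSign o h • ∫ s in {s | radialPoint s ∈ region ρ}, F.fiberForm o h (radialPoint s) θ

/-- The blow-up Whitney form `ψ_F`: at `x` with quasi-cylindrical coordinates `(ρ, θ)`, the form
`ψ_{F,ρ}` at `θ`, evaluated at the projections of the tangent vectors to the `Θ` factor. -/
def psi [DecidableEq V] (o : FaceOrientation V) (F : SimplexFlag V p) {k : ℕ}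
    (h : Fintype.card V = k + p + 1) : SimplexForm V k := fun x =>
  (F.angularForm o h (F.rho x) (F.theta x)).compContinuousLinearMap
    ((fderiv ℝ F.theta (x : V → ℝ)).comp (tangentSpace V).subtypeL)

end SimplexFlag

/-- The space of blow-up Whitney `k`-forms: the span of the `ψ_F`. -/
def blowUpWhitney {V : Type*} [Fintype V] [DecidableEq V] (o : FaceOrientation V) (k : ℕ) :
    Submodule ℝ (SimplexForm V k) :=
  Submodule.span ℝ {ψ | ∃ (p : ℕ) (F : SimplexFlag V p) (h : Fintype.card V = k + p + 1),
    ψ = F.psi o h}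

end

end BlowUp

/-!
The forms `ψ_F` become simple in the logarithmic coordinates `y_i = log λ_i`. Let
`F = (V_0, …, V_p)`, let `d_j = |V_j| - 1`, and let `C_F = dλ_V (1_{V_0}, …, 1_{V_p}, ·)` be the
constant form obtained by inserting the indicator vectors of the blocks (`logForm`). The pullback of
`ω` under `Φ`, contracted with the radial frame, is `n! ∏ r_j ^ d_j` times a form that depends on `θ`
only (`fiberForm_eq`). Writing `n!` as `∫ T ^ n exp (-T) dT` turns the integral over `R_ρ` into an
integral over the cone on `R_ρ`, and the substitution `r_j = ρ_j u_j` leads to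
`G_F(ρ) = ∫ ∏ u_j ^ d_j exp (-∑ ρ_j u_j) du`, taken over the chamber `0 ≤ u_0 ≤ … ≤ u_p`
(`chamberIntegral`, `factorial_mul_setIntegral_region`). The result is
`ψ_F = ± G_F(ρ(λ)) ∏ λ_i • C_F (dλ / λ)` (`psi_eq`). In the increments of `u` the integral `G_F` is
the Laplace transform of a polynomial over an orthant, so it is a rational function of `ρ`, and `ψ_F`
is smooth.

Consequently `dψ_F` is the pullback under the logarithm of `± dg ∧ C_F`, where `g = G_F ∏ λ_i`
(`d_psi_eq`). Contracting `dg ∧ dλ_V = 0` with the vectors `1_{V_j}` expresses `dg ∧ C_F` as an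
alternating sum of `∂g/∂1_{V_j}` times the contraction of `dλ_V` with the remaining indicator vectors
(`wedge_logForm`). The derivative of `g` along `1_{V_j}` is what integration by parts in `u_j`
produces: it is the difference of the integrals over the walls `u_j = u_{j+1}` and `u_{j-1} = u_j`
of the chamber (`chamberIntegral_castSucc`, `chamberIntegral_last`), and the integral over
`u_j = u_{j+1}` is `G_{F_j}` (`wallIntegral_succ`). Summation by parts collects, as the coefficient
of `G_{F_j}`, the sum of the contractions that omit `1_{V_j}` and `1_{V_{j+1}}`; this sum is `C_{F_j}`
because the indicator vector of `V_j ∪ V_{j+1}` is `1_{V_j} + 1_{V_{j+1}}` (`logForm_merge`). Hence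
`dψ_F` is a sum of the `ψ_{F_j}` with signs (`d_psi_eq_sum`, `exists_sign_d_psi`).

The orientation of `R` is the sign of `C_F` on the oriented frame of `Θ` (`radialSign_eq`), which is
not zero because the indicator vectors and this frame form a basis of `ℝ^V`. A transposition in the
ordering of the block `V_j ∪ V_{j+1}` therefore changes the sign of `ψ_{F_j}`. As this set is neither a
block of `F` nor a block of another `F_i`, the signs can be corrected independently of each other
(`exists_orientation`).
-/

namespace BlowUp

noncomputable section

/-! ### Laplace integrals over the chamber -/

open MvPolynomial

/-- The Laplace transform of polynomials over the positive orthant: the functional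
`P ↦ ∫_{w ≥ 0} P(w) exp (-∑ σ_l w_l) dw`, given on monomials by `∏ a_l! / σ_l ^ (a_l + 1)`. -/
def laplace {m : ℕ} (σ : Fin m → ℝ) : MvPolynomial (Fin m) ℝ →ₗ[ℝ] ℝ :=
  (basisMonomials (Fin m) ℝ).constr ℝ fun a => ∏ l, ((a l).factorial / σ l ^ (a l + 1) : ℝ)

theorem laplace_monomial {m : ℕ} (σ : Fin m → ℝ) (a : Fin m →₀ ℕ) (c : ℝ) :
    laplace σ (monomial a c) = c * ∏ l, ((a l).factorial / σ l ^ (a l + 1) : ℝ) := by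
  have h : monomial a c = c • basisMonomials (Fin m) ℝ a := by
    simp [smul_monomial]
  rw [h, map_smul, laplace, Module.Basis.constr_basis, smul_eq_mul]

/-- Differentiation of the Laplace transform with respect to its parameters. -/
theorem hasFDerivAt_laplace {m : ℕ} (P : MvPolynomial (Fin m) ℝ) (σ : Fin m → ℝ)
    (hσ : ∀ l, σ l ≠ 0) :
    HasFDerivAt (fun σ => laplace σ P)
      (∑ l, (-laplace σ (X l * P)) • ContinuousLinearMap.proj (R := ℝ) (φ := fun _ => ℝ) l) σ := by
  induction P using MvPolynomial.induction_on' with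
  | monomial a c =>
    simp only [laplace_monomial]
    have h1 : ∀ l : Fin m, HasFDerivAt (fun σ : Fin m → ℝ => ((a l).factorial / σ l ^ (a l + 1) : ℝ))
        ((-((a l + 1).factorial / σ l ^ (a l + 2)) : ℝ) •
          ContinuousLinearMap.proj (R := ℝ) (φ := fun _ => ℝ) l) σ := by
      intro l
      have h2 : HasDerivAt (fun t : ℝ => ((a l).factorial / t ^ (a l + 1) : ℝ))
          (-((a l + 1).factorial / σ l ^ (a l + 2)) : ℝ) (σ l) := by
        have h3 := (hasDerivAt_const (σ l) ((a l).factorial : ℝ)).fun_div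
          (hasDerivAt_pow (a l + 1) (σ l)) (pow_ne_zero _ (hσ l))
        refine h3.congr_deriv ?_
        have := hσ l
        rw [Nat.factorial_succ]
        push_cast
        field_simp
        ring_nf
      exact HasDerivAt.comp_hasFDerivAt (f := fun σ : Fin m → ℝ => σ l) σ h2 (hasFDerivAt_apply l σ)
    have h4 := (HasFDerivAt.finsetProd (u := Finset.univ) fun l _ => h1 l).const_mul c
    refine h4.congr_fderiv ?_
    rw [Finset.smul_sum]
    refine Finset.sum_congr rfl fun l _ => ?_
    rw [smul_smul, smul_smul]
    congr 1
    symm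
    rw [X, monomial_mul, laplace_monomial, ← Finset.mul_prod_erase _ _ (Finset.mem_univ l)]
    have h5 : ∏ x ∈ Finset.univ.erase l, (((Finsupp.single l 1 + a : Fin m →₀ ℕ) x).factorial /
        σ x ^ ((Finsupp.single l 1 + a : Fin m →₀ ℕ) x + 1) : ℝ) =
        ∏ x ∈ Finset.univ.erase l, ((a x).factorial / σ x ^ (a x + 1) : ℝ) := by
      refine Finset.prod_congr rfl fun x hx => ?_
      rw [Finsupp.add_apply, Finsupp.single_eq_of_ne (Finset.ne_of_mem_erase hx), zero_add]
    rw [h5]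
    simp only [Finsupp.add_apply, Finsupp.single_eq_same, add_comm 1 (a l), one_mul]
    ring
  | add P Q hP hQ =>
    simp only [mul_add, map_add, neg_add, add_smul, Finset.sum_add_distrib]
    exact hP.add hQ

theorem contDiffAt_laplace {m : ℕ} (P : MvPolynomial (Fin m) ℝ) (σ : Fin m → ℝ)
    (hσ : ∀ l, σ l ≠ 0) : ContDiffAt ℝ ∞ (fun σ => laplace σ P) σ := by
  induction P using MvPolynomial.induction_on' with
  | monomial a c =>
    simp only [laplace_monomial]
    refine contDiffAt_const.mul (contDiffAt_prod fun l _ => ?_)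
    exact contDiffAt_const.div ((contDiff_apply ℝ ℝ l).contDiffAt.pow _) (pow_ne_zero _ (hσ l))
  | add P Q hP hQ =>
    simp only [map_add]
    exact hP.add hQ

/-- Setting the variable `X_l` to zero. -/
def killVar {m : ℕ} (l : Fin (m + 1)) :
    MvPolynomial (Fin (m + 1)) ℝ →ₐ[ℝ] MvPolynomial (Fin m) ℝ :=
  aeval (Fin.insertNth (α := fun _ => MvPolynomial (Fin m) ℝ) l 0 X)

/-- Integration by parts in the variable `w_l`. -/
theorem laplace_pderiv {m : ℕ} (σ : Fin (m + 1) → ℝ) (l : Fin (m + 1)) (hσ : σ l ≠ 0)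
    (P : MvPolynomial (Fin (m + 1)) ℝ) :
    laplace σ (pderiv l P) =
      σ l * laplace σ P - laplace (fun i => σ (l.succAbove i)) (killVar l P) := by
  induction P using MvPolynomial.induction_on' with
  | add P Q hP hQ =>
    simp only [map_add, hP, hQ]
    ring
  | monomial a c =>
    have hk : killVar l (monomial a c) = (0 : MvPolynomial (Fin m) ℝ) ^ (a l) *
        monomial (Finsupp.equivFunOnFinite.symm fun i => a (l.succAbove i)) c := by
      rw [killVar, aeval_monomial, Finsupp.prod_fintype _ _ (by simp), Fin.prod_univ_succAbove _ l]
      simp only [Fin.insertNth_apply_same, Fin.insertNth_apply_succAbove]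
      rw [monomial_eq, Finsupp.prod_fintype _ _ (by simp), algebraMap_eq]
      simp only [Finsupp.equivFunOnFinite_symm_apply_apply]
      ring
    rw [pderiv_monomial, laplace_monomial, laplace_monomial, hk,
      Fin.prod_univ_succAbove _ l, Fin.prod_univ_succAbove _ l]
    have h5 : ∀ i : Fin m,
        (a - Finsupp.single l 1 : Fin (m + 1) →₀ ℕ) (l.succAbove i) = a (l.succAbove i) := by
      intro i
      rw [Finsupp.tsub_apply, Finsupp.single_eq_of_ne (Fin.succAbove_ne l i), tsub_zero]
    have h6 : (a - Finsupp.single l 1 : Fin (m + 1) →₀ ℕ) l = a l - 1 := by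
      rw [Finsupp.tsub_apply, Finsupp.single_eq_same]
    simp only [h5, h6]
    rcases Nat.eq_zero_or_pos (a l) with h | h
    · rw [h, pow_zero, one_mul, laplace_monomial]
      simp only [Finsupp.equivFunOnFinite_symm_apply_apply]
      simp
      field_simp
      ring
    · obtain ⟨b, hb⟩ := Nat.exists_eq_succ_of_ne_zero h.ne'
      rw [hb, zero_pow (Nat.succ_ne_zero b), zero_mul, map_zero, sub_zero]
      simp only [Nat.succ_eq_add_one, Nat.add_sub_cancel, Nat.factorial_succ]
      push_cast
      field_simp
      ring

/-- The partial sum `U_j = X_0 + … + X_j`: the variable `u_j` in terms of the increments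
`w_l = u_l - u_{l-1}`. -/
def partialSum {m : ℕ} (j : Fin m) : MvPolynomial (Fin m) ℝ := ∑ l ∈ Finset.univ.filter (· ≤ j), X l

/-- The tail sums `σ_l = ρ_l + ρ_{l+1} + …`, for which `∑ ρ_j u_j = ∑ σ_l w_l`. -/
def tail {m : ℕ} : (Fin m → ℝ) →L[ℝ] (Fin m → ℝ) :=
  ContinuousLinearMap.pi fun l =>
    ∑ i ∈ Finset.univ.filter (l ≤ ·), ContinuousLinearMap.proj (R := ℝ) (φ := fun _ => ℝ) i

theorem tail_apply {m : ℕ} (ρ : Fin m → ℝ) (l : Fin m) :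
    tail ρ l = ∑ i ∈ Finset.univ.filter (l ≤ ·), ρ i := by
  simp [tail]

theorem tail_pos {m : ℕ} {ρ : Fin m → ℝ} (hρ : ∀ j, 0 < ρ j) (l : Fin m) : 0 < tail ρ l := by
  rw [tail_apply]
  exact Finset.sum_pos (fun i _ => hρ i) ⟨l, by simp⟩

/-- The polynomial `∏ U_j ^ d_j`. -/
def chamberPoly {m : ℕ} (d : Fin m → ℕ) : MvPolynomial (Fin m) ℝ := ∏ j, partialSum j ^ d j

/-- The function `G_d(ρ) = ∫_{0 ≤ u_0 ≤ … ≤ u_p} ∏ u_j ^ d_j exp (-∑ ρ_j u_j) du`, written in the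
increments `w` of `u`. -/
def chamberIntegral {m : ℕ} (d : Fin m → ℕ) (ρ : Fin m → ℝ) : ℝ :=
  laplace (tail ρ) (chamberPoly d)

theorem contDiffAt_chamberIntegral {m : ℕ} (d : Fin m → ℕ) {ρ : Fin m → ℝ} (hρ : ∀ j, 0 < ρ j) :
    ContDiffAt ℝ ∞ (chamberIntegral d) ρ :=
  (contDiffAt_laplace (chamberPoly d) (tail ρ) fun l => (tail_pos hρ l).ne').comp ρ
    tail.contDiff.contDiffAt

theorem hasFDerivAt_chamberIntegral {m : ℕ} (d : Fin m → ℕ) {ρ : Fin m → ℝ} (hρ : ∀ j, 0 < ρ j) :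
    HasFDerivAt (chamberIntegral d)
      (∑ j, (-laplace (tail ρ) (partialSum j * chamberPoly d)) •
        ContinuousLinearMap.proj (R := ℝ) (φ := fun _ => ℝ) j) ρ := by
  have h := (hasFDerivAt_laplace (chamberPoly d) (tail ρ) fun l => (tail_pos hρ l).ne').comp ρ
    tail.hasFDerivAt
  refine h.congr_fderiv ?_
  ext v
  simp only [ContinuousLinearMap.comp_apply, sum_apply,
    smul_apply, ContinuousLinearMap.proj_apply, tail_apply, partialSum,
    Finset.sum_mul, map_sum, smul_eq_mul, Finset.mul_sum, ← Finset.sum_neg_distrib]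
  rw [Finset.sum_comm' (t' := Finset.univ) (s' := fun i => Finset.univ.filter (· ≤ i))]
  simp

/-- The boundary term of the integration by parts in the increment `w_l`: the integral of
`u_l ∏ u_j ^ d_j exp (-∑ ρ_j u_j)` over the wall `w_l = 0` of the chamber. -/
def wallIntegral {m : ℕ} (d : Fin (m + 1) → ℕ) (ρ : Fin (m + 1) → ℝ) (l : Fin (m + 1)) : ℝ :=
  laplace (fun i => tail ρ (l.succAbove i)) (killVar l (partialSum l * chamberPoly d))

theorem killVar_X_self {m : ℕ} (l : Fin (m + 1)) : killVar l (X l) = 0 := by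
  simp [killVar]

theorem killVar_X_succAbove {m : ℕ} (l : Fin (m + 1)) (i : Fin m) :
    killVar l (X (l.succAbove i)) = X i := by
  simp [killVar]

theorem wallIntegral_zero {m : ℕ} (d : Fin (m + 1) → ℕ) (ρ : Fin (m + 1) → ℝ) :
    wallIntegral d ρ 0 = 0 := by
  have h : (partialSum (0 : Fin (m + 1))) = X 0 := by
    have : Finset.univ.filter (· ≤ (0 : Fin (m + 1))) = {0} := by ext; simp
    rw [partialSum, this, Finset.sum_singleton]
  rw [wallIntegral, h, map_mul, killVar_X_self, zero_mul, map_zero]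

theorem partialSum_succ {m : ℕ} (j : Fin m) :
    partialSum j.succ = partialSum j.castSucc + X j.succ := by
  have : Finset.univ.filter (· ≤ j.succ) =
      insert j.succ (Finset.univ.filter (· ≤ j.castSucc)) := by
    ext x
    simp only [Finset.mem_filter, Finset.mem_univ, true_and, Finset.mem_insert]
    simp only [Fin.le_def, Fin.ext_iff, Fin.val_succ, Fin.val_castSucc]
    omega
  rw [partialSum, this, Finset.sum_insert (by simp [Fin.le_def]), partialSum]
  ring

theorem tail_castSucc {m : ℕ} (ρ : Fin (m + 1) → ℝ) (j : Fin m) :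
    tail ρ j.castSucc = ρ j.castSucc + tail ρ j.succ := by
  have : Finset.univ.filter (j.castSucc ≤ ·) =
      insert j.castSucc (Finset.univ.filter (j.succ ≤ ·)) := by
    ext x
    simp only [Finset.mem_filter, Finset.mem_univ, true_and, Finset.mem_insert]
    simp only [Fin.le_def, Fin.ext_iff, Fin.val_succ, Fin.val_castSucc]
    omega
  rw [tail_apply, this, Finset.sum_insert (by simp [Fin.le_def]), tail_apply]

theorem tail_last {m : ℕ} (ρ : Fin (m + 1) → ℝ) : tail ρ (Fin.last m) = ρ (Fin.last m) := by
  have : Finset.univ.filter (Fin.last m ≤ ·) = {Fin.last m} := by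
    ext x; simp [Fin.last_le_iff]
  rw [tail_apply, this, Finset.sum_singleton]

theorem pderiv_partialSum {m : ℕ} (l j : Fin m) :
    pderiv l (partialSum j) = if l ≤ j then 1 else 0 := by
  simp only [partialSum, map_sum, pderiv_X, Pi.single_apply]
  simp

/-- If a derivation `δ` acts on the partial sums as `∂ / ∂u_j`, then
`δ (U_j ∏ U_i ^ d_i) = (d_j + 1) ∏ U_i ^ d_i`. -/
theorem derivation_partialSum_mul_chamberPoly {m : ℕ} (d : Fin m → ℕ) (j : Fin m)
    (δ : Derivation ℝ (MvPolynomial (Fin m) ℝ) (MvPolynomial (Fin m) ℝ))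
    (hδ : ∀ i, δ (partialSum i) = if i = j then 1 else 0) :
    δ (partialSum j * chamberPoly d) = ((d j : ℝ) + 1) • chamberPoly d := by
  have h0 : ∀ s : Finset (Fin m), j ∉ s → δ (∏ i ∈ s, partialSum i ^ d i) = 0 := by
    intro s
    induction s using Finset.induction_on with
    | empty => intro _; simp
    | insert a s ha ih =>
      intro hj
      rw [Finset.mem_insert, not_or] at hj
      rw [Finset.prod_insert ha, Derivation.leibniz, ih hj.2, Derivation.leibniz_pow, hδ,
        if_neg (Ne.symm hj.1)]
      simp
  have h1 : partialSum j * chamberPoly d =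
      partialSum j ^ (d j + 1) * ∏ i ∈ Finset.univ.erase j, partialSum i ^ d i := by
    rw [chamberPoly, ← Finset.mul_prod_erase _ _ (Finset.mem_univ j)]
    ring
  rw [h1, Derivation.leibniz, h0 _ (Finset.notMem_erase j _), Derivation.leibniz_pow, hδ,
    if_pos rfl, chamberPoly, ← Finset.mul_prod_erase _ _ (Finset.mem_univ j)]
  simp only [smul_eq_mul, nsmul_eq_mul, MvPolynomial.smul_eq_C_mul, map_add, map_natCast, map_one]
  push_cast
  simp
  ring

/-- Integration by parts in the variable `u_j`, whose range `u_{j-1} ≤ u_j ≤ u_{j+1}` produces two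
boundary terms. -/
theorem chamberIntegral_castSucc {m : ℕ} (d : Fin (m + 1) → ℕ) {ρ : Fin (m + 1) → ℝ}
    (hρ : ∀ j, 0 < ρ j) (j : Fin m) :
    ((d j.castSucc : ℝ) + 1) * chamberIntegral d ρ -
        ρ j.castSucc * laplace (tail ρ) (partialSum j.castSucc * chamberPoly d) =
      wallIntegral d ρ j.succ - wallIntegral d ρ j.castSucc := by
  have h := derivation_partialSum_mul_chamberPoly d j.castSucc
    (pderiv j.castSucc - pderiv j.succ) (by
      intro i
      rw [Derivation.sub_apply, pderiv_partialSum, pderiv_partialSum]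
      simp only [Fin.le_def, Fin.ext_iff, Fin.val_succ, Fin.val_castSucc]
      split_ifs <;> first | omega | simp)
  have h2 := congrArg (laplace (tail ρ)) h
  rw [Derivation.sub_apply, map_sub, map_smul, laplace_pderiv _ _ (tail_pos hρ _).ne',
    laplace_pderiv _ _ (tail_pos hρ _).ne', smul_eq_mul, tail_castSucc] at h2
  have h3 : killVar j.succ (partialSum j.castSucc * chamberPoly d) =
      killVar j.succ (partialSum j.succ * chamberPoly d) := by
    rw [partialSum_succ, map_mul, map_mul, map_add, killVar_X_self, add_zero]
  rw [h3] at h2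
  rw [chamberIntegral, ← h2, wallIntegral, wallIntegral]
  ring

/-- Integration by parts in the last variable: there is no boundary term at infinity. -/
theorem chamberIntegral_last {m : ℕ} (d : Fin (m + 1) → ℕ) {ρ : Fin (m + 1) → ℝ}
    (hρ : ∀ j, 0 < ρ j) :
    ((d (Fin.last m) : ℝ) + 1) * chamberIntegral d ρ -
        ρ (Fin.last m) * laplace (tail ρ) (partialSum (Fin.last m) * chamberPoly d) =
      - wallIntegral d ρ (Fin.last m) := by
  have h := derivation_partialSum_mul_chamberPoly d (Fin.last m) (pderiv (Fin.last m)) (by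
      intro i
      rw [pderiv_partialSum]
      simp [Fin.last_le_iff])
  have h2 := congrArg (laplace (tail ρ)) h
  rw [map_smul, laplace_pderiv _ _ (tail_pos hρ _).ne', smul_eq_mul, tail_last] at h2
  rw [chamberIntegral, ← h2, wallIntegral]
  ring

theorem val_predAbove {q : ℕ} (j : Fin (q + 1)) (i : Fin (q + 2)) :
    (j.predAbove i).val = if j.val < i.val then i.val - 1 else i.val := by
  rw [Fin.predAbove]
  by_cases h : j.val < i.val
  · simp [Fin.lt_def, h]
  · simp [Fin.lt_def, h]

theorem val_succAbove {q : ℕ} (l : Fin (q + 1)) (i : Fin q) :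
    (l.succAbove i).val = if i.val < l.val then i.val else i.val + 1 := by
  rw [Fin.succAbove]
  by_cases h : i.val < l.val
  · simp [Fin.lt_def, h]
  · simp [Fin.lt_def, h]

theorem killVar_succ_partialSum {q : ℕ} (j : Fin (q + 1)) (i : Fin (q + 2)) :
    killVar j.succ (partialSum i) = partialSum (j.predAbove i) := by
  rw [partialSum, map_sum, Finset.sum_filter, Fin.sum_univ_succAbove _ j.succ, killVar_X_self,
    ite_self, zero_add, partialSum, Finset.sum_filter]
  refine Finset.sum_congr rfl fun l _ => ?_
  rw [killVar_X_succAbove]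
  congr 1
  rw [eq_iff_iff, Fin.le_def, Fin.le_def, val_predAbove, val_succAbove, Fin.val_succ]
  split_ifs <;> omega

/-- On the wall `u_j = u_{j+1}` the chamber integral turns into that of the merged data. -/
theorem wallIntegral_succ {q : ℕ} (d : Fin (q + 2) → ℕ) (ρ : Fin (q + 2) → ℝ) (j : Fin (q + 1))
    (d' : Fin (q + 1) → ℕ) (ρ' : Fin (q + 1) → ℝ)
    (hd : ∀ i, d' i = d (j.succ.succAbove i) + if i = j then d j.succ + 1 else 0)
    (hρ : ∀ i, ρ' i = ρ (j.succ.succAbove i) + if i = j then ρ j.succ else 0) :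
    wallIntegral d ρ j.succ = chamberIntegral d' ρ' := by
  have hpred : ∀ i : Fin (q + 1), j.predAbove (j.succ.succAbove i) = i := by
    intro i
    rw [Fin.ext_iff, val_predAbove, val_succAbove, Fin.val_succ]
    split_ifs <;> omega
  have h1 : (fun i => tail ρ (j.succ.succAbove i)) = tail ρ' := by
    funext l
    rw [tail_apply, tail_apply, Finset.sum_filter, Finset.sum_filter,
      Fin.sum_univ_succAbove _ j.succ]
    simp only [hρ]
    have h2 : ∀ i, (if l ≤ i then ρ (j.succ.succAbove i) + (if i = j then ρ j.succ else 0) else 0) =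
        (if l ≤ i then ρ (j.succ.succAbove i) else 0) +
          (if i = j then (if l ≤ j then ρ j.succ else 0) else 0) := by
      intro i
      by_cases hij : i = j
      · subst hij
        split_ifs <;> simp
      · simp [hij]
    simp only [h2, Finset.sum_add_distrib, Finset.sum_ite_eq', Finset.mem_univ, if_true,
      Fin.succAbove_le_succAbove_iff]
    rw [add_comm]
    congr 2
    rw [Fin.succAbove]
    split_ifs with h1 <;>
      simp only [Fin.le_def, Fin.lt_def, Fin.val_succ, Fin.val_castSucc, eq_iff_iff] at * <;> omega
  rw [wallIntegral, chamberIntegral, h1, map_mul, killVar_succ_partialSum, chamberPoly, map_prod,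
    Fin.prod_univ_succAbove _ j.succ]
  simp only [map_pow, killVar_succ_partialSum, hpred]
  rw [Fin.predAbove_succ_self, chamberPoly]
  simp only [hd, pow_add]
  rw [Finset.prod_mul_distrib]
  have h3 : ∏ i, (partialSum i : MvPolynomial (Fin (q + 1)) ℝ) ^
      (if i = j then d j.succ + 1 else 0) = partialSum j ^ (d j.succ + 1) := by
    simp [pow_ite, Finset.prod_ite_eq']
  rw [h3, pow_succ]
  refine congrArg _ ?_
  rw [mul_comm (partialSum j ^ d j.succ) (partialSum j), mul_left_comm, mul_comm (∏ i, _) _,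
    mul_assoc, mul_left_comm]

/-! ### The fibre integral over `R_ρ` -/

open MvPolynomial MeasureTheory Set

theorem integral_pow_mul_exp_neg_mul_Ici (a : ℕ) {r : ℝ} (hr : 0 < r) :
    ∫ t in Ici (0 : ℝ), t ^ a * Real.exp (-(r * t)) = (a.factorial / r ^ (a + 1) : ℝ) := by
  have h := Real.integral_rpow_mul_exp_neg_mul_Ioi (a := a + 1) (r := r) (by positivity) hr
  rw [integral_Ici_eq_integral_Ioi]
  rw [Real.Gamma_nat_eq_factorial] at h
  simp only [add_sub_cancel_right, Real.rpow_natCast] at h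
  rw [h]
  have : ((a : ℝ) + 1) = ((a + 1 : ℕ) : ℝ) := by push_cast; rfl
  rw [this, Real.rpow_natCast, one_div, inv_pow]
  field_simp

theorem integrableOn_pow_mul_exp_neg_mul_Ici (a : ℕ) {r : ℝ} (hr : 0 < r) :
    IntegrableOn (fun t : ℝ => t ^ a * Real.exp (-(r * t))) (Ici 0) := by
  -- if the function were not integrable, its integral would be zero by convention
  by_contra h
  have h1 := integral_pow_mul_exp_neg_mul_Ici a hr
  rw [integral_undef h] at h1
  have : (0 : ℝ) < a.factorial / r ^ (a + 1) := by positivity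
  exact this.ne h1

/-- The functional `laplace` is the Laplace transform over the orthant. -/
theorem laplace_eq_integral {m : ℕ} {σ : Fin m → ℝ} (hσ : ∀ l, 0 < σ l)
    (P : MvPolynomial (Fin m) ℝ) :
    IntegrableOn (fun w : Fin m → ℝ => eval w P * Real.exp (-∑ l, σ l * w l)) (univ.pi fun _ => Ici 0)
      ∧ ∫ w in univ.pi fun _ => Ici 0, eval w P * Real.exp (-∑ l, σ l * w l) = laplace σ P := by
  have hm : (volume : Measure (Fin m → ℝ)).restrict (univ.pi fun _ => Ici 0) =
      Measure.pi fun _ => (volume : Measure ℝ).restrict (Ici 0) := by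
    rw [volume_pi, Measure.restrict_pi_pi]
  rw [IntegrableOn, hm]
  induction P using MvPolynomial.induction_on' with
  | monomial a c =>
    have h1 : (fun w : Fin m → ℝ => eval w (monomial a c) * Real.exp (-∑ l, σ l * w l)) =
        fun w => c * ∏ l, (w l ^ a l * Real.exp (-(σ l * w l))) := by
      funext w
      rw [eval_monomial, Finsupp.prod_fintype _ _ (by simp), Finset.prod_mul_distrib,
        ← Real.exp_sum, Finset.sum_neg_distrib]
      ring
    rw [h1, laplace_monomial, integral_const_mul,
      integral_fintype_prod_eq_prod (fun l (t : ℝ) => t ^ a l * Real.exp (-(σ l * t)))]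
    refine ⟨Integrable.const_mul (Integrable.fintype_prod fun l =>
      integrableOn_pow_mul_exp_neg_mul_Ici (a l) (hσ l)) c, ?_⟩
    simp only [integral_pow_mul_exp_neg_mul_Ici _ (hσ _)]
  | add P Q hP hQ =>
    simp only [map_add, add_mul]
    exact ⟨hP.1.add hQ.1, by rw [integral_add hP.1 hQ.1, hP.2, hQ.2]⟩

theorem laplace_eq_lintegral {m : ℕ} {σ : Fin m → ℝ} (hσ : ∀ l, 0 < σ l)
    (P : MvPolynomial (Fin m) ℝ) (hP : ∀ w : Fin m → ℝ, (∀ l, 0 ≤ w l) → 0 ≤ eval w P) :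
    ∫⁻ w in univ.pi fun _ => Ici 0, ENNReal.ofReal (eval w P * Real.exp (-∑ l, σ l * w l)) =
      ENNReal.ofReal (laplace σ P) := by
  obtain ⟨h1, h2⟩ := laplace_eq_integral hσ P
  rw [← h2, ofReal_integral_eq_lintegral_ofReal h1]
  refine (ae_restrict_iff' (MeasurableSet.univ_pi fun _ => measurableSet_Ici)).2 (.of_forall ?_)
  intro w hw
  have := hP w fun l => hw l (mem_univ l)
  simp only [Pi.zero_apply]
  positivity

/-- The cone over `R_ρ`. -/
def cone {m : ℕ} (ρ : Fin m → ℝ) : Set (Fin m → ℝ) :=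
  {u | (∀ j, 0 ≤ u j) ∧ ∀ j j', j ≤ j' → u j / ρ j ≤ u j' / ρ j'}

theorem measurableSet_cone {m : ℕ} (ρ : Fin m → ℝ) : MeasurableSet (cone ρ) := by
  refine MeasurableSet.inter (s₁ := {u : Fin m → ℝ | ∀ j, 0 ≤ u j})
    (s₂ := {u : Fin m → ℝ | ∀ j j', j ≤ j' → u j / ρ j ≤ u j' / ρ j'}) ?_ ?_
  · simp only [ofPred_forall]
    exact MeasurableSet.iInter fun j => measurableSet_le measurable_const (measurable_pi_apply j)
  · simp only [ofPred_forall]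
    exact MeasurableSet.iInter fun j => MeasurableSet.iInter fun j' => MeasurableSet.iInter fun _ =>
      measurableSet_le ((measurable_pi_apply j).div_const _) ((measurable_pi_apply j').div_const _)

/-- The integrand `∏ u_j ^ d_j exp (-∑ u_j)` on the cone over `R_ρ`. -/
def coneDensity {m : ℕ} (d : Fin m → ℕ) (ρ : Fin m → ℝ) : (Fin m → ℝ) → ENNReal :=
  (cone ρ).indicator fun u => ENNReal.ofReal ((∏ j, u j ^ d j) * Real.exp (-∑ j, u j))

theorem measurable_coneDensity {m : ℕ} (d : Fin m → ℕ) (ρ : Fin m → ℝ) :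
    Measurable (coneDensity d ρ) := by
  refine Measurable.indicator ?_ (measurableSet_cone ρ)
  have : Continuous fun u : Fin m → ℝ => (∏ j, u j ^ d j) * Real.exp (-∑ j, u j) := by fun_prop
  exact this.measurable.ennreal_ofReal

theorem eval_partialSum {m : ℕ} (w : Fin m → ℝ) (j : Fin m) :
    eval w (partialSum j) = ∑ l ∈ Finset.univ.filter (· ≤ j), w l := by
  simp [partialSum]

theorem eval_chamberPoly_nonneg {m : ℕ} (d : Fin m → ℕ) (w : Fin m → ℝ) (hw : ∀ l, 0 ≤ w l) :
    0 ≤ eval w (chamberPoly d) := by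
  rw [chamberPoly, map_prod]
  refine Finset.prod_nonneg fun j _ => ?_
  rw [map_pow, eval_partialSum]
  exact pow_nonneg (Finset.sum_nonneg fun l _ => hw l) _

/-- The matrix of `w ↦ (ρ_j (w_0 + … + w_j))_j`, which maps the orthant onto the cone over
`R_ρ`. -/
def coneMatrix {m : ℕ} (ρ : Fin m → ℝ) : Matrix (Fin m) (Fin m) ℝ :=
  Matrix.of fun j l => if l ≤ j then ρ j else 0

theorem det_coneMatrix {m : ℕ} (ρ : Fin m → ℝ) : (coneMatrix ρ).det = ∏ j, ρ j := by
  rw [Matrix.det_of_isLowerTriangular]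
  · simp [coneMatrix]
  · intro i j hij
    simp only [coneMatrix, Matrix.of_apply]
    rw [if_neg (not_le.2 (by simpa using hij))]

theorem coneMatrix_mulVec {m : ℕ} (ρ w : Fin m → ℝ) (j : Fin m) :
    (coneMatrix ρ).mulVec w j = ρ j * eval w (partialSum j) := by
  rw [eval_partialSum, Matrix.mulVec, dotProduct, Finset.sum_filter, Finset.mul_sum]
  refine Finset.sum_congr rfl fun l _ => ?_
  simp only [coneMatrix, Matrix.of_apply]
  split_ifs <;> simp

theorem coneMatrix_mulVec_mem_cone {m : ℕ} {ρ : Fin m → ℝ} (hρ : ∀ j, 0 < ρ j) (w : Fin m → ℝ) :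
    (coneMatrix ρ).mulVec w ∈ cone ρ ↔ w ∈ univ.pi fun _ => Ici (0 : ℝ) := by
  have hdiv : ∀ j, (coneMatrix ρ).mulVec w j / ρ j = eval w (partialSum j) := by
    intro j
    rw [coneMatrix_mulVec, mul_div_cancel_left₀ _ (hρ j).ne']
  have hnn : ∀ j, 0 ≤ (coneMatrix ρ).mulVec w j ↔ 0 ≤ eval w (partialSum j) := by
    intro j
    rw [coneMatrix_mulVec, mul_nonneg_iff_of_pos_left (hρ j)]
  simp only [cone, mem_ofPred_eq, hdiv, hnn, mem_pi, mem_univ, forall_const, mem_Ici]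
  constructor
  · rintro ⟨h1, h2⟩ l
    cases m with
    | zero => exact l.elim0
    | succ m =>
      refine Fin.cases ?_ (fun l => ?_) l
      · have h3 := h1 0
        have : Finset.univ.filter (· ≤ (0 : Fin (m + 1))) = {0} := by ext; simp
        rwa [eval_partialSum, this, Finset.sum_singleton] at h3
      · have h3 := h2 l.castSucc l.succ (Fin.castSucc_lt_succ).le
        rw [partialSum_succ, map_add, eval_X] at h3
        linarith
  · intro h
    refine ⟨fun j => ?_, fun j j' hj => ?_⟩
    · rw [eval_partialSum]
      exact Finset.sum_nonneg fun l _ => h l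
    · rw [eval_partialSum, eval_partialSum]
      refine Finset.sum_le_sum_of_subset_of_nonneg ?_ fun l _ _ => h l
      intro l hl
      simp only [Finset.mem_filter, Finset.mem_univ, true_and] at hl ⊢
      exact hl.trans hj

theorem lintegral_comp_mulVec {m : ℕ} (M : Matrix (Fin m) (Fin m) ℝ) (hM : M.det ≠ 0)
    {f : (Fin m → ℝ) → ENNReal} (hf : Measurable f) :
    ∫⁻ u, f u = ENNReal.ofReal |M.det| * ∫⁻ w, f (M.mulVec w) := by
  have h := Real.map_matrix_volume_pi_eq_smul_volume_pi hM
  have hmeas : Measurable (Matrix.toLin' M) := by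
    exact (LinearMap.continuous_of_finiteDimensional _).measurable
  have h1 : ∫⁻ w, f (M.mulVec w) = ∫⁻ u, f u ∂(Measure.map (Matrix.toLin' M) volume) := by
    rw [lintegral_map hf hmeas]
    rfl
  rw [h1, h, lintegral_smul_measure, smul_eq_mul, ← mul_assoc, ← ENNReal.ofReal_mul (abs_nonneg _),
    abs_inv, mul_inv_cancel₀ (abs_ne_zero.2 hM), ENNReal.ofReal_one, one_mul]

/-- In the coordinates `w` the integral over the cone is a Laplace transform. -/
theorem lintegral_coneDensity {m : ℕ} (d : Fin m → ℕ) {ρ : Fin m → ℝ} (hρ : ∀ j, 0 < ρ j) :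
    ∫⁻ u, coneDensity d ρ u =
      ENNReal.ofReal ((∏ j, ρ j ^ (d j + 1)) * chamberIntegral d ρ) := by
  have hdet : (coneMatrix ρ).det ≠ 0 := by
    rw [det_coneMatrix]
    exact (Finset.prod_pos fun j _ => hρ j).ne'
  rw [lintegral_comp_mulVec _ hdet (measurable_coneDensity d ρ), det_coneMatrix,
    abs_of_pos (Finset.prod_pos fun j _ => hρ j)]
  have hsum : ∀ w : Fin m → ℝ, ∑ j, (coneMatrix ρ).mulVec w j = ∑ l, tail ρ l * w l := by
    intro w
    simp only [coneMatrix_mulVec, eval_partialSum, tail_apply, Finset.mul_sum, Finset.sum_mul]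
    rw [Finset.sum_comm' (t' := Finset.univ) (s' := fun i => Finset.univ.filter (i ≤ ·))]
    simp
  have h1 : ∀ w, coneDensity d ρ ((coneMatrix ρ).mulVec w) =
      ENNReal.ofReal (∏ j, ρ j ^ d j) * (univ.pi fun _ => Ici (0 : ℝ)).indicator (fun w =>
        ENNReal.ofReal (eval w (chamberPoly d) * Real.exp (-∑ l, tail ρ l * w l))) w := by
    intro w
    by_cases hw : w ∈ univ.pi fun _ => Ici (0 : ℝ)
    · rw [coneDensity, indicator_of_mem ((coneMatrix_mulVec_mem_cone hρ w).2 hw),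
        indicator_of_mem hw, ← ENNReal.ofReal_mul (Finset.prod_nonneg fun j _ => by
          have := hρ j; positivity), hsum, ← mul_assoc, chamberPoly, map_prod,
        ← Finset.prod_mul_distrib]
      simp only [coneMatrix_mulVec, mul_pow, map_pow]
    · rw [coneDensity, indicator_of_notMem (fun h => hw ((coneMatrix_mulVec_mem_cone hρ w).1 h)),
        indicator_of_notMem hw, mul_zero]
  simp only [h1]
  rw [lintegral_const_mul' _ _ ENNReal.ofReal_ne_top,
    lintegral_indicator (MeasurableSet.univ_pi fun _ => measurableSet_Ici),
    laplace_eq_lintegral (tail_pos hρ) _ (eval_chamberPoly_nonneg d), ← mul_assoc,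
    ← ENNReal.ofReal_mul (Finset.prod_nonneg fun j _ => (hρ j).le), ← Finset.prod_mul_distrib,
    ← ENNReal.ofReal_mul (Finset.prod_nonneg fun j _ => by have := hρ j; positivity),
    chamberIntegral]
  simp only [pow_succ']

theorem sum_radialPoint {p : ℕ} (s : Fin p → ℝ) : ∑ j, SimplexFlag.radialPoint s j = 1 := by
  simp [SimplexFlag.radialPoint, Fin.sum_univ_succ]

theorem continuous_radialPoint {p : ℕ} :
    Continuous (SimplexFlag.radialPoint : (Fin p → ℝ) → Fin (p + 1) → ℝ) := by
  refine continuous_pi fun j => ?_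
  refine Fin.cases ?_ (fun l => ?_) j
  · simp only [SimplexFlag.radialPoint, Fin.cons_zero]
    fun_prop
  · simp only [SimplexFlag.radialPoint, Fin.cons_succ]
    fun_prop

/-- Integration over `ℝ^(p+1)` by slicing with the hyperplanes `∑ u_j = T`, each slice being
parametrized by `s ↦ T r(s)`. -/
theorem lintegral_slice {p : ℕ} {f : (Fin (p + 1) → ℝ) → ENNReal} (hf : Measurable f) :
    ∫⁻ u, f u = ∫⁻ T : ℝ, ENNReal.ofReal (|T| ^ p) *
      ∫⁻ s : Fin p → ℝ, f (T • SimplexFlag.radialPoint s) := by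
  have e := (volume_preserving_piFinSuccAbove (fun _ : Fin (p + 1) => ℝ) 0).symm
  have hcons : ∀ q : ℝ × (Fin p → ℝ),
      (MeasurableEquiv.piFinSuccAbove (fun _ : Fin (p + 1) => ℝ) 0).symm q = Fin.cons q.1 q.2 := by
    intro q
    simp [MeasurableEquiv.piFinSuccAbove, Fin.insertNthEquiv]
  have hmc : Measurable fun q : ℝ × (Fin p → ℝ) => (Fin.cons q.1 q.2 : Fin (p + 1) → ℝ) := by
    rw [← funext hcons]
    exact (MeasurableEquiv.piFinSuccAbove (fun _ : Fin (p + 1) => ℝ) 0).symm.measurable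
  have hshear : Measurable fun q : ℝ × (Fin p → ℝ) =>
      (Fin.cons (q.1 - ∑ l, q.2 l) q.2 : Fin (p + 1) → ℝ) := by
    exact hmc.comp (Measurable.prodMk (by fun_prop) measurable_snd)
  have h1 : ∫⁻ u, f u = ∫⁻ q : ℝ × (Fin p → ℝ), f (Fin.cons q.1 q.2) := by
    rw [← e.lintegral_comp hf]
    simp only [hcons]
  -- for fixed `u_1, …, u_p`, replace `u_0` by the sum `T` of all coordinates
  have h2 : ∫⁻ q : ℝ × (Fin p → ℝ), f (Fin.cons q.1 q.2) =
      ∫⁻ T : ℝ, ∫⁻ u : Fin p → ℝ, f (Fin.cons (T - ∑ l, u l) u) := by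
    rw [Measure.volume_eq_prod, lintegral_prod_symm' (fun q : ℝ × (Fin p → ℝ) =>
      f (Fin.cons q.1 q.2)) (hf.comp hmc)]
    have h3 : ∀ u : Fin p → ℝ, ∫⁻ t : ℝ, f (Fin.cons t u) =
        ∫⁻ T : ℝ, f (Fin.cons (T - ∑ l, u l) u) := fun u =>
      (lintegral_sub_right_eq_self (fun t : ℝ => f (Fin.cons t u)) (∑ l, u l)).symm
    simp only [h3]
    exact lintegral_lintegral_swap (hf.comp (hshear.comp measurable_swap)).aemeasurable
  rw [h1, h2]
  refine lintegral_congr_ae ?_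
  have h0 : ∀ᵐ T : ℝ, T ≠ 0 := by
    simp [ae_iff]
  filter_upwards [h0] with T hT
  have hdet : ((T • 1 : Matrix (Fin p) (Fin p) ℝ)).det ≠ 0 := by
    rw [Matrix.det_smul]
    simp [hT]
  have hm : Measurable fun u : Fin p → ℝ => f (Fin.cons (T - ∑ l, u l) u) :=
    hf.comp (hshear.comp measurable_prodMk_left)
  rw [lintegral_comp_mulVec _ hdet hm, Matrix.det_smul, Matrix.det_one, mul_one, Fintype.card_fin,
    abs_pow]
  congr 1
  refine lintegral_congr fun s => ?_
  congr 1
  funext j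
  refine Fin.cases ?_ (fun l => ?_) j
  · simp [SimplexFlag.radialPoint, Matrix.smul_mulVec, ← Finset.mul_sum, mul_sub]
  · simp [SimplexFlag.radialPoint, Matrix.smul_mulVec]

theorem radialPoint_mem_region_iff {p : ℕ} (ρ : Fin (p + 1) → ℝ) (s : Fin p → ℝ) :
    SimplexFlag.radialPoint s ∈ SimplexFlag.region ρ ↔ SimplexFlag.radialPoint s ∈ cone ρ := by
  simp only [SimplexFlag.region, cone, mem_ofPred_eq, sum_radialPoint, true_and]

theorem measurableSet_region {p : ℕ} (ρ : Fin (p + 1) → ℝ) :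
    MeasurableSet {s : Fin p → ℝ | SimplexFlag.radialPoint s ∈ SimplexFlag.region ρ} := by
  simp only [radialPoint_mem_region_iff]
  exact continuous_radialPoint.measurable (measurableSet_cone ρ)

theorem smul_mem_cone {m : ℕ} {ρ : Fin m → ℝ} {T : ℝ} (hT : 0 < T) (u : Fin m → ℝ) :
    T • u ∈ cone ρ ↔ u ∈ cone ρ := by
  simp only [cone, mem_ofPred_eq, Pi.smul_apply, smul_eq_mul, mul_nonneg_iff_of_pos_left hT,
    mul_div_assoc, mul_le_mul_iff_right₀ hT]

/-- The integral over `R_ρ`: slicing the integral over the cone turns the exponential into a factor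
`n!`. -/
theorem factorial_mul_setIntegral_region {p : ℕ} (d : Fin (p + 1) → ℕ) {ρ : Fin (p + 1) → ℝ}
    (hρ : ∀ j, 0 < ρ j) {n : ℕ} (hn : n = ∑ j, d j + p) :
    (n.factorial : ℝ) * ∫ s in {s | SimplexFlag.radialPoint s ∈ SimplexFlag.region ρ},
        ∏ j, SimplexFlag.radialPoint s j ^ d j =
      (∏ j, ρ j ^ (d j + 1)) * chamberIntegral d ρ := by
  set I : ENNReal := ∫⁻ s in {s | SimplexFlag.radialPoint s ∈ SimplexFlag.region ρ},
    ENNReal.ofReal (∏ j, SimplexFlag.radialPoint s j ^ d j) with hI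
  have hslice : ∀ T : ℝ, T ≠ 0 → ENNReal.ofReal (|T| ^ p) *
      ∫⁻ s : Fin p → ℝ, coneDensity d ρ (T • SimplexFlag.radialPoint s) =
      (Ici (0 : ℝ)).indicator (fun T => ENNReal.ofReal (T ^ n * Real.exp (-(1 * T)))) T * I := by
    intro T hT0
    have hsum : ∀ s : Fin p → ℝ, ∑ j, (T • SimplexFlag.radialPoint s) j = T := by
      intro s
      simp only [Pi.smul_apply, smul_eq_mul, ← Finset.mul_sum, sum_radialPoint, mul_one]
    rcases lt_or_gt_of_ne hT0 with hT | hT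
    · rw [indicator_of_notMem (by simpa using hT), zero_mul]
      have : ∀ s : Fin p → ℝ, coneDensity d ρ (T • SimplexFlag.radialPoint s) = 0 := by
        intro s
        refine indicator_of_notMem (fun h => ?_) _
        have := Finset.sum_nonneg fun j (_ : j ∈ Finset.univ) => h.1 j
        rw [hsum] at this
        linarith
      simp only [this, lintegral_zero, mul_zero]
    · rw [indicator_of_mem (mem_Ici.2 hT.le), hI, ← lintegral_indicator (measurableSet_region ρ),
        ← lintegral_const_mul' _ _ ENNReal.ofReal_ne_top,
        ← lintegral_const_mul' _ _ ENNReal.ofReal_ne_top]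
      refine lintegral_congr fun s => ?_
      by_cases hs : SimplexFlag.radialPoint s ∈ cone ρ
      · rw [coneDensity, indicator_of_mem ((smul_mem_cone hT _).2 hs),
          indicator_of_mem (by exact (radialPoint_mem_region_iff ρ s).2 hs), hsum,
          ← ENNReal.ofReal_mul (by positivity), ← ENNReal.ofReal_mul (by positivity)]
        congr 1
        simp only [Pi.smul_apply, smul_eq_mul, mul_pow, Finset.prod_mul_distrib,
          Finset.prod_pow_eq_pow_sum, hn, pow_add, abs_of_pos hT, one_mul]
        ring
      · rw [coneDensity, indicator_of_notMem (fun h => hs ((smul_mem_cone hT _).1 h)),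
          indicator_of_notMem (s := {s | SimplexFlag.radialPoint s ∈ SimplexFlag.region ρ})
            (fun h => hs ((radialPoint_mem_region_iff ρ s).1 h)), mul_zero, mul_zero]
  have h0 : ∀ᵐ T : ℝ, T ≠ 0 := by
    simp [ae_iff]
  have hG : ∫⁻ T : ℝ, (Ici (0 : ℝ)).indicator
      (fun T => ENNReal.ofReal (T ^ n * Real.exp (-(1 * T)))) T = ENNReal.ofReal n.factorial := by
    rw [lintegral_indicator measurableSet_Ici, ← ofReal_integral_eq_lintegral_ofReal
      (integrableOn_pow_mul_exp_neg_mul_Ici n one_pos), integral_pow_mul_exp_neg_mul_Ici n one_pos]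
    · simp
    · refine (ae_restrict_iff' measurableSet_Ici).2 (.of_forall fun T hT => ?_)
      have hT' : (0 : ℝ) ≤ T := hT
      simp only [Pi.zero_apply]
      positivity
  have hmain : ENNReal.ofReal n.factorial * I =
      ENNReal.ofReal ((∏ j, ρ j ^ (d j + 1)) * chamberIntegral d ρ) := by
    rw [← lintegral_coneDensity d hρ, lintegral_slice (measurable_coneDensity d ρ), ← hG,
      lintegral_congr_ae (h0.mono hslice), lintegral_mul_const _ (Measurable.indicator
        (by fun_prop) measurableSet_Ici)]
  have hnn : 0 ≤ (∏ j, ρ j ^ (d j + 1)) * chamberIntegral d ρ := by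
    refine mul_nonneg (Finset.prod_nonneg fun j _ => by have := hρ j; positivity) ?_
    rw [chamberIntegral, ← (laplace_eq_integral (tail_pos hρ) (chamberPoly d)).2]
    refine setIntegral_nonneg (MeasurableSet.univ_pi fun _ => measurableSet_Ici) fun w hw => ?_
    exact mul_nonneg (eval_chamberPoly_nonneg d w fun l => hw l (mem_univ l)) (Real.exp_nonneg _)
  have hint : ∫ s in {s | SimplexFlag.radialPoint s ∈ SimplexFlag.region ρ},
      ∏ j, SimplexFlag.radialPoint s j ^ d j = I.toReal := by
    refine integral_eq_lintegral_of_nonneg_ae ?_ ?_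
    · refine (ae_restrict_iff' (measurableSet_region ρ)).2 (.of_forall fun s hs => ?_)
      exact Finset.prod_nonneg fun j _ => pow_nonneg (hs.1 j) _
    · have := continuous_radialPoint (p := p)
      have h2 : Continuous fun s : Fin p → ℝ => ∏ j, SimplexFlag.radialPoint s j ^ d j := by
        fun_prop
      exact h2.aestronglyMeasurable
  have := congrArg ENNReal.toReal hmain
  rwa [ENNReal.toReal_mul, ENNReal.toReal_ofReal hnn, ENNReal.toReal_ofReal (by positivity),
    ← hint] at this

/-! ### Contractions and the logarithmic form -/

section Contract

variable {E : Type*} [NormedAddCommGroup E] [NormedSpace ℝ E]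

theorem contract_smul {k : ℕ} (p : ℕ) (c : ℝ) (η : E [⋀^Fin (k + p)]→L[ℝ] ℝ) (v : Fin p → E) :
    contract p (c • η) v = c • contract p η v := by
  induction p with
  | zero => rfl
  | succ p ih =>
    have h : ContinuousAlternatingMap.curryLeft (n := k + p) (c • η) (v 0) =
        c • ContinuousAlternatingMap.curryLeft (n := k + p) η (v 0) := rfl
    rw [contract, h, ih, contract]

theorem contract_add {k : ℕ} (p : ℕ) (η ξ : E [⋀^Fin (k + p)]→L[ℝ] ℝ) (v : Fin p → E) :
    contract p (η + ξ) v = contract p η v + contract p ξ v := by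
  induction p with
  | zero => rfl
  | succ p ih =>
    have h : ContinuousAlternatingMap.curryLeft (n := k + p) (η + ξ) (v 0) =
        ContinuousAlternatingMap.curryLeft (n := k + p) η (v 0) +
        ContinuousAlternatingMap.curryLeft (n := k + p) ξ (v 0) := rfl
    rw [contract, h, ih, contract, contract]

theorem contract_zero {k : ℕ} (p : ℕ) (v : Fin p → E) :
    contract p (0 : E [⋀^Fin (k + p)]→L[ℝ] ℝ) v = 0 := by
  have := contract_smul p (0 : ℝ) (0 : E [⋀^Fin (k + p)]→L[ℝ] ℝ) v
  rwa [zero_smul, zero_smul] at this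

theorem contract_neg {k : ℕ} (p : ℕ) (η : E [⋀^Fin (k + p)]→L[ℝ] ℝ) (v : Fin p → E) :
    contract p (-η) v = -contract p η v := by
  rw [← neg_one_smul ℝ η, contract_smul]
  ext w
  exact neg_one_mul _

theorem contract_comp {E' : Type*} [NormedAddCommGroup E'] [NormedSpace ℝ E'] {k : ℕ} (p : ℕ)
    (η : E' [⋀^Fin (k + p)]→L[ℝ] ℝ) (f : E →L[ℝ] E') (v : Fin p → E) :
    contract p (η.compContinuousLinearMap f) v =
      (contract p η (fun l => f (v l))).compContinuousLinearMap f := by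
  induction p with
  | zero => rfl
  | succ p ih =>
    rw [contract, ContinuousAlternatingMap.curryLeft_compContinuousLinearMap (n := k + p), ih,
      contract]

theorem contract_smul_vectors {k : ℕ} (p : ℕ) (η : E [⋀^Fin (k + p)]→L[ℝ] ℝ) (c : Fin p → ℝ)
    (v : Fin p → E) : contract p η (fun l => c l • v l) = (∏ l, c l) • contract p η v := by
  induction p with
  | zero => simp [contract]
  | succ p ih =>
    rw [contract, map_smul, contract_smul, ih _ (fun l => c l.succ), contract, smul_smul,
      Fin.prod_univ_succ]

theorem curryLeft_swap {n : ℕ} (η : E [⋀^Fin (n + 1 + 1)]→L[ℝ] ℝ) (u v : E) :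
    (η.curryLeft u).curryLeft v = -(η.curryLeft v).curryLeft u := by
  ext w
  change η (Matrix.vecCons u (Matrix.vecCons v w)) = -η (Matrix.vecCons v (Matrix.vecCons u w))
  have h := η.toAlternatingMap.map_swap (Matrix.vecCons v (Matrix.vecCons u w))
    (i := 0) (j := 1) (by simp)
  change η _ = -η _ at h
  rw [← h]
  congr 1
  funext i
  refine Fin.cases ?_ (fun i => Fin.cases ?_ (fun i => ?_) i) i
  · simp
  · simp
  · have h0 : (i.succ.succ : Fin (n + 1 + 1)) ≠ 0 := Fin.succ_ne_zero _
    have h1 : (i.succ.succ : Fin (n + 1 + 1)) ≠ 1 := by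
      intro h
      exact Fin.succ_ne_zero i (Fin.succ_injective _ h)
    simp [Equiv.swap_apply_of_ne_of_ne h0 h1]

theorem contract_curryLeft_mem {k : ℕ} (p : ℕ) (η : E [⋀^Fin (k + p + 1)]→L[ℝ] ℝ) (v : Fin p → E)
    (l : Fin p) : contract p (η.curryLeft (v l)) v = 0 := by
  induction p with
  | zero => exact l.elim0
  | succ p ih =>
    rw [contract]
    refine Fin.cases ?_ (fun l => ?_) l
    · erw [η.curryLeft_same (v 0)]
      exact contract_zero p _
    · have h := curryLeft_swap η (v l.succ) (v 0)
      erw [h]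
      rw [contract_neg]
      have h2 := ih (η.curryLeft (v 0)) (fun l => v l.succ) l
      erw [h2]
      exact neg_zero

theorem contract_curryLeft_sub {k : ℕ} (p : ℕ) (η : E [⋀^Fin (k + p + 1)]→L[ℝ] ℝ) (u : E)
    (v : Fin p → E) :
    contract p (η.curryLeft u) (fun l => v l - u) = contract p (η.curryLeft u) v := by
  induction p with
  | zero => rfl
  | succ p ih =>
    rw [contract, contract]
    have h0 : (η.curryLeft u).curryLeft (v 0 - u) = -(η.curryLeft (v 0)).curryLeft u := by
      rw [map_sub, ContinuousAlternatingMap.curryLeft_same, sub_zero, curryLeft_swap]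
    have h2 := curryLeft_swap η u (v 0)
    erw [h0, h2]
    rw [contract_neg, contract_neg]
    have h3 := ih (η.curryLeft (v 0)) (fun l => v l.succ)
    erw [h3]

/-- The contraction with `b_0, …, b_p` does not change if `b_0` is replaced by an affine combination
of the `b_j`, and the other `b_j` by `b_j - b_0`. -/
theorem contract_affine {k : ℕ} (p : ℕ) (η : E [⋀^Fin (k + (p + 1))]→L[ℝ] ℝ)
    (b : Fin (p + 1) → E) (r : Fin (p + 1) → ℝ) (hr : ∑ j, r j = 1) :
    contract (p + 1) η (Fin.cons (∑ j, r j • b j) fun l => b l.succ - b 0) =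
      contract (p + 1) η b := by
  rw [contract, contract]
  simp only [Fin.cons_zero, Fin.cons_succ]
  have h : ∑ j, r j • b j = b 0 + ∑ l : Fin p, r l.succ • (b l.succ - b 0) := by
    rw [Fin.sum_univ_succ] at hr ⊢
    simp only [smul_sub, Finset.sum_sub_distrib, ← Finset.sum_smul]
    rw [eq_sub_of_add_eq hr]
    module
  rw [h, map_add, contract_add, map_sum]
  have h2 : ∀ s : Finset (Fin p), contract p (∑ l ∈ s, ContinuousAlternatingMap.curryLeft (n := k + p) η
      (r l.succ • (b l.succ - b 0))) (fun l => b l.succ - b 0) = 0 := by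
    intro s
    induction s using Finset.induction_on with
    | empty => rw [Finset.sum_empty]; exact contract_zero p _
    | insert l s hl ih =>
      rw [Finset.sum_insert hl, contract_add, ih, map_smul, contract_smul,
        contract_curryLeft_mem p η (fun l => b l.succ - b 0) l, smul_zero, add_zero]
  rw [h2, add_zero]
  exact contract_curryLeft_sub p η (b 0) fun l => b l.succ

/-- `u` lies in the kernel of the form `η`: the form vanishes as soon as one argument is `u`. Every
vector is in the kernel of a form of degree zero. -/
def IsKernelVector {k : ℕ} (η : E [⋀^Fin k]→L[ℝ] ℝ) (u : E) : Prop :=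
  ∀ (w : Fin k → E) (a : Fin k), w a = u → η w = 0

theorem IsKernelVector.contract {k : ℕ} (p : ℕ) {η : E [⋀^Fin (k + p)]→L[ℝ] ℝ} {u : E}
    (h : IsKernelVector η u) (v : Fin p → E) : IsKernelVector (contract p η v) u := by
  induction p with
  | zero => exact h
  | succ p ih =>
    refine ih (fun w a hw => ?_) _
    exact h (Matrix.vecCons (v 0) w) a.succ (by simpa using hw)

theorem isKernelVector_contract {k : ℕ} (p : ℕ) (η : E [⋀^Fin (k + p)]→L[ℝ] ℝ) (v : Fin p → E)
    (l : Fin p) : IsKernelVector (contract p η v) (v l) := by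
  induction p with
  | zero => exact l.elim0
  | succ p ih =>
    refine Fin.cases ?_ (fun l => ?_) l
    · refine IsKernelVector.contract p (fun w a hw => ?_) _
      exact η.map_eq_zero_of_eq (Matrix.vecCons (v 0) w) (i := 0) (j := a.succ) (by simp [hw])
        (Fin.succ_ne_zero a).symm
    · exact ih (ContinuousAlternatingMap.curryLeft (n := k + p) η (v 0)) (fun l => v l.succ) l

theorem IsKernelVector.sum_smul {k : ℕ} {η : E [⋀^Fin k]→L[ℝ] ℝ} {ι : Type*} [Fintype ι]
    {u : ι → E} (h : ∀ i, IsKernelVector η (u i)) (c : ι → ℝ) :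
    IsKernelVector η (∑ i, c i • u i) := by
  intro w a hw
  have h1 : w = Function.update w a (∑ i, c i • u i) := by rw [← hw, Function.update_eq_self]
  rw [h1]
  have h2 := η.toMultilinearMap.map_update_sum Finset.univ a (fun i => c i • u i) w
  refine h2.trans (Finset.sum_eq_zero fun i _ => ?_)
  rw [MultilinearMap.map_update_smul]
  have := h i (Function.update w a (u i)) a (by simp)
  erw [this]
  simp

/-- The value of a form only depends on its arguments modulo its kernel. -/
theorem map_add_of_isKernelVector {k : ℕ} {η : E [⋀^Fin k]→L[ℝ] ℝ} (w z : Fin k → E)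
    (hz : ∀ a, IsKernelVector η (z a)) : η (fun a => w a + z a) = η w := by
  have h := η.toMultilinearMap.map_add_univ w z
  refine h.trans ((Finset.sum_eq_single Finset.univ (fun s _ hs => ?_) (by simp)).trans ?_)
  · obtain ⟨a, ha⟩ : ∃ a, a ∉ s := by
      by_contra hcon
      push Not at hcon
      exact hs (Finset.eq_univ_iff_forall.2 hcon)
    exact hz a _ a (Finset.piecewise_eq_of_notMem _ _ _ ha)
  · rw [Finset.piecewise_univ]
    rfl

end Contract

section Scaling

variable {V : Type*}

/-- Multiplication of the coordinates by the numbers `c i`. -/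
def scale (c : V → ℝ) : (V → ℝ) →L[ℝ] (V → ℝ) :=
  ContinuousLinearMap.pi fun i => c i • ContinuousLinearMap.proj (R := ℝ) (φ := fun _ => ℝ) i

@[simp]
theorem scale_apply (c v : V → ℝ) (i : V) : scale c v i = c i * v i := by
  simp [scale]

variable [Fintype V]

theorem dLambda_apply (o : FaceOrientation V) {N : ℕ} (h : (Finset.univ : Finset V).card = N)
    (v : Fin N → V → ℝ) : dLambda o Finset.univ h v =
      Matrix.det (Matrix.of fun a b => v a (o Finset.univ (Fin.cast h.symm b) : V)) := rfl

theorem dLambda_comp_scale (o : FaceOrientation V) {N : ℕ} (h : (Finset.univ : Finset V).card = N)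
    (c : V → ℝ) : (dLambda o Finset.univ h).compContinuousLinearMap (scale c) =
      (∏ i, c i) • dLambda o Finset.univ h := by
  ext v
  rw [ContinuousAlternatingMap.compContinuousLinearMap_apply, ContinuousAlternatingMap.smul_apply,
    dLambda_apply, dLambda_apply, smul_eq_mul]
  have h1 : ∏ i, c i = ∏ b : Fin N, c (o Finset.univ (Fin.cast h.symm b) : V) := by
    rw [← Equiv.prod_comp ((finCongr h.symm).trans ((o Finset.univ).trans
      (Equiv.subtypeUnivEquiv fun x => Finset.mem_univ x))) c]
    rfl
  rw [h1, ← Matrix.det_mul_row]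
  rfl

end Scaling

namespace SimplexFlag

variable {V : Type*} {p : ℕ}

/-- The indicator vector of the block `V_j`. -/
def blockVec (F : SimplexFlag V p) (j : Fin (p + 1)) : V → ℝ :=
  fun i => if F.blk i = j then 1 else 0

theorem sum_smul_blockVec (F : SimplexFlag V p) (r : Fin (p + 1) → ℝ) :
    ∑ j, r j • F.blockVec j = fun i => r (F.blk i) := by
  funext i
  simp [blockVec, Finset.sum_apply]

variable [Fintype V]

/-- The exponents `d_j = |V_j| - 1`. -/
def deg (F : SimplexFlag V p) (j : Fin (p + 1)) : ℕ := (F.block j).card - 1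

theorem deg_add_one (F : SimplexFlag V p) (j : Fin (p + 1)) : F.deg j + 1 = (F.block j).card := by
  have := F.block_card_pos j
  rw [deg]
  omega

theorem prod_blk (F : SimplexFlag V p) (r : Fin (p + 1) → ℝ) :
    ∏ i, r (F.blk i) = ∏ j, r j ^ (F.deg j + 1) := by
  rw [← Finset.prod_fiberwise Finset.univ F.blk]
  refine Finset.prod_congr rfl fun j _ => ?_
  rw [deg_add_one, block, Finset.prod_congr rfl fun i hi => by rw [(Finset.mem_filter.1 hi).2],
    Finset.prod_const]

/-- The constant form `dλ_V (1_{V_0}, …, 1_{V_p}, ·)`: in logarithmic coordinates, `ψ_F` is a function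
times this form. -/
def logForm (o : FaceOrientation V) (F : SimplexFlag V p) {k : ℕ} (h : Fintype.card V = k + p + 1) :
    (V → ℝ) [⋀^Fin k]→L[ℝ] ℝ :=
  contract (p + 1) (dLambda o Finset.univ h) F.blockVec

theorem isKernelVector_logForm (o : FaceOrientation V) (F : SimplexFlag V p) {k : ℕ}
    (h : Fintype.card V = k + p + 1) (j : Fin (p + 1)) :
    IsKernelVector (F.logForm o h) (F.blockVec j) :=
  isKernelVector_contract (p + 1) _ F.blockVec j

/-- `logForm` lives on the quotient of `ℝ^V` by the block vectors, on which multiplication of the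
blocks by the numbers `r_j` has determinant `∏ r_j ^ d_j`. -/
theorem logForm_scale (o : FaceOrientation V) (F : SimplexFlag V p) {k : ℕ}
    (h : Fintype.card V = k + p + 1) (r : Fin (p + 1) → ℝ) (w : Fin k → V → ℝ) :
    F.logForm o h (fun a => scale (fun i => r (F.blk i)) (w a)) =
      (∏ j, r j ^ F.deg j) * F.logForm o h w := by
  -- the formula is proved for nonzero `r_j`, and extended by continuity
  have hdense : Dense (Set.univ.pi fun _ : Fin (p + 1) => ({0}ᶜ : Set ℝ)) :=
    dense_pi Set.univ fun _ _ => dense_compl_singleton 0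
  refine congrFun (Continuous.ext_on hdense (f := fun r : Fin (p + 1) → ℝ =>
    F.logForm o h (fun a => scale (fun i => r (F.blk i)) (w a)))
    (g := fun r => (∏ j, r j ^ F.deg j) * F.logForm o h w) ?_ (by fun_prop) ?_) r
  · refine (F.logForm o h).cont.comp (continuous_pi fun a => continuous_pi fun i => ?_)
    simp only [scale_apply]
    fun_prop
  · intro r hr
    have hr0 : ∀ j, r j ≠ 0 := fun j => hr j (Set.mem_univ j)
    have h1 : F.blockVec = fun j => scale (fun i => r (F.blk i)) ((r j)⁻¹ • F.blockVec j) := by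
      funext j i
      simp only [scale_apply, Pi.smul_apply, smul_eq_mul, blockVec]
      split_ifs with hi
      · rw [hi, mul_one, mul_inv_cancel₀ (hr0 j)]
      · simp
    have h2 := contract_comp (p + 1) (dLambda o Finset.univ h) (scale fun i => r (F.blk i))
      (fun j => (r j)⁻¹ • F.blockVec j)
    rw [← h1] at h2
    have h3 := congrArg (fun η => η w) h2
    erw [dLambda_comp_scale] at h3
    rw [contract_smul, contract_smul_vectors, smul_smul, prod_blk, ← Finset.prod_mul_distrib] at h3
    simp only [pow_succ, mul_assoc, mul_inv_cancel₀ (hr0 _), mul_one] at h3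
    exact h3.symm

theorem fderiv_cyl (F : SimplexFlag V p) (r a : Fin (p + 1) → ℝ) (θ b : V → ℝ) :
    fderiv ℝ F.cyl (r, θ) (a, b) = fun i => r (F.blk i) * b i + a (F.blk i) * θ i := by
  have h : HasFDerivAt F.cyl (ContinuousLinearMap.pi fun i =>
      r (F.blk i) • (ContinuousLinearMap.proj (R := ℝ) (φ := fun _ : V => ℝ) i).comp
          (ContinuousLinearMap.snd ℝ (Fin (p + 1) → ℝ) (V → ℝ)) +
        θ i • (ContinuousLinearMap.proj (R := ℝ) (φ := fun _ : Fin (p + 1) => ℝ) (F.blk i)).comp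
          (ContinuousLinearMap.fst ℝ (Fin (p + 1) → ℝ) (V → ℝ))) (r, θ) := by
    refine hasFDerivAt_pi.2 fun i => ?_
    exact (((ContinuousLinearMap.proj (R := ℝ) (φ := fun _ : Fin (p + 1) => ℝ) (F.blk i)).comp
          (ContinuousLinearMap.fst ℝ (Fin (p + 1) → ℝ) (V → ℝ))).hasFDerivAt (x := (r, θ))).mul
      (((ContinuousLinearMap.proj (R := ℝ) (φ := fun _ : V => ℝ) i).comp
          (ContinuousLinearMap.snd ℝ (Fin (p + 1) → ℝ) (V → ℝ))).hasFDerivAt (x := (r, θ)))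
  rw [h.fderiv]
  funext i
  simp [mul_comm (θ i)]

/-- The fibre form in closed form. The point `Φ(r, θ)` and the images of the radial frame are affine
combinations and differences of the block vectors scaled by `θ`. -/
theorem fiberForm_eq (o : FaceOrientation V) (F : SimplexFlag V p) {k : ℕ}
    (h : Fintype.card V = k + p + 1) (r : Fin (p + 1) → ℝ) (hr : ∑ j, r j = 1) (θ : V → ℝ)
    (hθ : ∀ i, θ i ≠ 0) :
    F.fiberForm o h r θ = ((k + p).factorial * (∏ i, θ i) * ∏ j, r j ^ F.deg j : ℝ) •
      (F.logForm o h).compContinuousLinearMap (scale fun i => (θ i)⁻¹) := by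
  ext Y
  have h1 : F.cyl (r, θ) = scale θ (∑ j, r j • F.blockVec j) := by
    funext i
    rw [scale_apply, sum_smul_blockVec, cyl, mul_comm]
  have h2 : ∀ l : Fin p, fderiv ℝ F.cyl (r, θ) (radialFrame V p l) =
      scale θ (F.blockVec l.succ - F.blockVec 0) := by
    intro l
    rw [radialFrame, fderiv_cyl]
    funext i
    simp [blockVec, Pi.single_apply, mul_comm]
  have h3 : ∀ y : V → ℝ, fderiv ℝ F.cyl (r, θ) (0, y) =
      scale θ (scale (fun i => r (F.blk i)) (scale (fun i => (θ i)⁻¹) y)) := by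
    intro y
    rw [fderiv_cyl]
    funext i
    have := hθ i
    simp only [scale_apply, Pi.zero_apply]
    field_simp
    ring
  have h4 : contract (p + 1) (dLambda o Finset.univ h) (Fin.cons (scale θ (∑ j, r j • F.blockVec j))
      fun l => scale θ (F.blockVec l.succ - F.blockVec 0))
      (fun a => scale θ (scale (fun i => r (F.blk i)) (scale (fun i => (θ i)⁻¹) (Y a)))) =
      (∏ i, θ i) * F.logForm o h
        (fun a => scale (fun i => r (F.blk i)) (scale (fun i => (θ i)⁻¹) (Y a))) := by
    have h5 := contract_comp (p + 1) (dLambda o Finset.univ h) (scale θ)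
      (Fin.cons (∑ j, r j • F.blockVec j) fun l => F.blockVec l.succ - F.blockVec 0)
    have h6 : (fun l => scale θ ((Fin.cons (∑ j, r j • F.blockVec j)
        fun l => F.blockVec l.succ - F.blockVec 0 : Fin (p + 1) → V → ℝ) l)) =
        Fin.cons (scale θ (∑ j, r j • F.blockVec j))
          fun l => scale θ (F.blockVec l.succ - F.blockVec 0) := by
      funext l
      refine Fin.cases rfl (fun l => rfl) l
    rw [h6] at h5
    erw [dLambda_comp_scale] at h5
    rw [contract_smul, contract_affine p _ F.blockVec r hr] at h5
    exact (congrArg (fun η => η fun a => scale (fun i => r (F.blk i))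
      (scale (fun i => (θ i)⁻¹) (Y a))) h5).symm
  have h7 : F.fiberForm o h r θ Y = ((k + p).factorial : ℝ) *
      contract (p + 1) (dLambda o Finset.univ h)
        (Fin.cons (F.cyl (r, θ)) fun l => fderiv ℝ F.cyl (r, θ) (radialFrame V p l))
        (fun a => fderiv ℝ F.cyl (r, θ) (0, Y a)) := by
    rw [fiberForm, contract_comp, whitneyForm, contract_smul]
    rfl
  rw [h7, h1]
  simp only [h2, h3]
  rw [h4, logForm_scale, ContinuousAlternatingMap.smul_apply, smul_eq_mul,
    ContinuousAlternatingMap.compContinuousLinearMap_apply]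
  simp only [Function.comp_def]
  ring

end SimplexFlag

/-! ### Smooth dependence and wedge products of contractions -/

section Contract

variable {E : Type*} [NormedAddCommGroup E] [NormedSpace ℝ E]

theorem contract_add_slot {k : ℕ} (p : ℕ) (η : E [⋀^Fin (k + p)]→L[ℝ] ℝ) (j : Fin p)
    (v v₁ v₂ : Fin p → E) (h₁ : ∀ i, i ≠ j → v i = v₁ i) (h₂ : ∀ i, i ≠ j → v i = v₂ i)
    (hj : v j = v₁ j + v₂ j) : contract p η v = contract p η v₁ + contract p η v₂ := by
  induction p with
  | zero => exact j.elim0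
  | succ p ih =>
    rw [contract, contract, contract]
    rcases Fin.eq_zero_or_eq_succ j with rfl | ⟨j, rfl⟩
    · have e₁ : (fun l : Fin p => v l.succ) = fun l => v₁ l.succ :=
        funext fun l => h₁ l.succ (Fin.succ_ne_zero l)
      have e₂ : (fun l : Fin p => v l.succ) = fun l => v₂ l.succ :=
        funext fun l => h₂ l.succ (Fin.succ_ne_zero l)
      rw [hj, map_add, contract_add, ← e₁, ← e₂]
    · rw [← h₁ 0 (Fin.succ_ne_zero j).symm, ← h₂ 0 (Fin.succ_ne_zero j).symm]
      exact ih _ j _ _ _ (fun i hi => h₁ _ (by simpa using hi)) (fun i hi => h₂ _ (by simpa using hi))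
        hj

theorem contDiffAt_contract {E' : Type*} [NormedAddCommGroup E'] [NormedSpace ℝ E'] {k : ℕ} (p : ℕ)
    {η : E' → E [⋀^Fin (k + p)]→L[ℝ] ℝ} {v : E' → Fin p → E} {t : E'}
    (hη : ContDiffAt ℝ ∞ η t) (hv : ∀ l, ContDiffAt ℝ ∞ (fun t => v t l) t) :
    ContDiffAt ℝ ∞ (fun t => contract p (η t) (v t)) t := by
  induction p with
  | zero => exact hη
  | succ p ih =>
    refine ih (η := fun t => ContinuousAlternatingMap.curryLeft (n := k + p) (η t) (v t 0)) ?_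
      fun l => hv l.succ
    let L : (E [⋀^Fin (k + p + 1)]→L[ℝ] ℝ) →L[ℝ] (E →L[ℝ] E [⋀^Fin (k + p)]→L[ℝ] ℝ) :=
      ContinuousAlternatingMap.curryLeftLI.toContinuousLinearMap
    exact (L.contDiff.contDiffAt.comp t hη).clm_apply (hv 0)

/-- The interior product is an antiderivation, for a wedge product `W = ℓ ∧ D` with a covector. -/
theorem curryLeft_wedge {n : ℕ} (l : E →L[ℝ] ℝ) (D : E [⋀^Fin n]→L[ℝ] ℝ)
    (W : E [⋀^Fin (n + 1)]→L[ℝ] ℝ)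
    (hW : ∀ v, W v = ∑ a : Fin (n + 1), (-1) ^ a.val * (l (v a) * D (a.removeNth v)))
    (b : E) (w : Fin n → E) : W.curryLeft b w = l b * D w -
      ∑ a : Fin n, (-1) ^ a.val * (l (w a) *
        D (Fin.removeNth (α := fun _ : Fin (n + 1) => E) a.succ (Matrix.vecCons b w))) := by
  change W (Matrix.vecCons b w) = _
  rw [hW, Fin.sum_univ_succ, sub_eq_add_neg, ← Finset.sum_neg_distrib]
  congr 1
  · simp
  · refine Finset.sum_congr rfl fun a _ => ?_
    simp only [Fin.val_succ, pow_succ, Matrix.cons_val_succ]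
    ring

/-- Contraction of `ℓ ∧ D` with `b_0, …, b_p`: the interior products act as antiderivations. The
form `D` appears twice, as `D` and `D'`, according to how its degree is written. -/
theorem contract_wedge {k : ℕ} (p : ℕ) (l : E →L[ℝ] ℝ) (D : E [⋀^Fin (k + 1 + p)]→L[ℝ] ℝ)
    (D' : E [⋀^Fin (k + (p + 1))]→L[ℝ] ℝ) (W : E [⋀^Fin (k + 1 + (p + 1))]→L[ℝ] ℝ)
    (hD : ∀ v, D v = D' fun a => v (Fin.cast (by omega) a))
    (hW : ∀ v, W v = ∑ a : Fin (k + 1 + p + 1), (-1) ^ a.val * (l (v a) * D (a.removeNth v)))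
    (b : Fin (p + 1) → E) :
    contract (p + 1) W b = ∑ j, ((-1) ^ j.val * l (b j)) • contract p D (fun i => b (j.succAbove i)) +
      ((-1) ^ (p + 1) : ℝ) • ContinuousAlternatingMap.alternatizeUncurryFin
        (l.smulRight (contract (p + 1) D' b)) := by
  induction p with
  | zero =>
    have h1 : contract (0 + 1) W b =
        ContinuousAlternatingMap.curryLeft (n := k + 1 + 0) W (b 0) := rfl
    rw [h1]
    ext w
    rw [curryLeft_wedge (n := k + 1 + 0) l D W hW]
    have h2 : ContinuousAlternatingMap.alternatizeUncurryFin
        (l.smulRight (contract (0 + 1) D' b)) w = ∑ a : Fin (k + 1), (-1) ^ a.val * (l (w a) *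
        D (Fin.removeNth (α := fun _ : Fin (k + 1 + 1) => E) a.succ (Matrix.vecCons (b 0) w))) := by
      rw [ContinuousAlternatingMap.alternatizeUncurryFin_apply]
      refine Finset.sum_congr rfl fun a _ => ?_
      rw [hD]
      simp only [ContinuousLinearMap.smulRight_apply, smul_eq_mul, zsmul_eq_mul, Int.cast_pow,
        Int.cast_neg, Int.cast_one, ContinuousAlternatingMap.smul_apply]
      congr 2
      change D' (Matrix.vecCons (b 0) (a.removeNth w)) = _
      congr 1
      funext i
      refine Fin.cases ?_ (fun i => ?_) i
      · simp [Fin.removeNth]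
      · simp [Fin.removeNth]
    simp only [ContinuousAlternatingMap.add_apply, ContinuousAlternatingMap.smul_apply]
    have h3 : ∑ j : Fin (0 + 1), ((-1) ^ j.val * l (b j)) • contract 0 D
        (fun i => b (j.succAbove i)) = l (b 0) • D := by
      rw [Fin.sum_univ_succ]
      simp [contract]
    erw [h3, h2]
    simp [sub_eq_add_neg]
  | succ p ih =>
    have hcons : ∀ {n : ℕ} (w : Fin (n + 1) → E) (a : Fin (n + 1)),
        Fin.removeNth (α := fun _ => E) a.succ (Matrix.vecCons (b 0) w) =
          Matrix.vecCons (b 0) (a.removeNth w) := by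
      intro n w a
      funext i
      refine Fin.cases ?_ (fun i => ?_) i
      · simp [Fin.removeNth]
      · simp [Fin.removeNth]
    have h := ih (ContinuousAlternatingMap.curryLeft (n := k + 1 + p) D (b 0))
      (ContinuousAlternatingMap.curryLeft (n := k + (p + 1)) D' (b 0))
      (l (b 0) • D - ContinuousAlternatingMap.curryLeft (n := k + 1 + (p + 1)) W (b 0))
      (fun v => by
        change D (Matrix.vecCons (b 0) v) = D' (Matrix.vecCons (b 0) _)
        rw [hD]
        congr 1
        funext i
        refine Fin.cases ?_ (fun i => ?_) i <;> rfl)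
      (fun v => by
        rw [ContinuousAlternatingMap.sub_apply, ContinuousAlternatingMap.smul_apply,
          curryLeft_wedge (n := k + 1 + (p + 1)) l D W hW, smul_eq_mul, sub_sub_cancel]
        refine Finset.sum_congr rfl fun a _ => ?_
        erw [hcons]
        rfl)
      (fun i => b i.succ)
    rw [sub_eq_add_neg, contract_add, contract_smul, contract_neg] at h
    have hneg : ∀ {n : ℕ} (c : ℝ) (x : E [⋀^Fin n]→L[ℝ] ℝ), -(c • x) = (-c) • x := by
      intro n c x
      ext w
      exact (neg_mul c (x w)).symm
    have hW' : contract (p + 1 + 1) W b = contract (p + 1)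
      (ContinuousAlternatingMap.curryLeft (n := k + 1 + (p + 1)) W (b 0)) fun i => b i.succ := rfl
    rw [hW', Fin.sum_univ_succ]
    rw [← sub_eq_add_neg, sub_eq_iff_eq_add] at h
    rw [eq_sub_of_add_eq' h.symm, sub_eq_add_neg, neg_add, ← Finset.sum_neg_distrib, ← add_assoc]
    congr 1
    · congr 1
      · simp
      · refine Finset.sum_congr rfl fun j _ => ?_
        rw [hneg, contract]
        simp only [Fin.succ_succAbove_zero, Fin.succ_succAbove_succ, Fin.val_succ, pow_succ]
        congr 1
        ring
    · rw [hneg, pow_succ _ (p + 1), mul_neg_one]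
      rfl

end Contract

/-! ### The closed form of `ψ_F` and its smoothness -/

namespace SimplexFlag

variable {V : Type*} {p : ℕ} [Fintype V]

theorem rho_eq_sum_blockVec (F : SimplexFlag V p) (x : V → ℝ) (j : Fin (p + 1)) :
    F.rho x j = ∑ i, F.blockVec j i * x i := by
  simp [rho, block, blockVec, Finset.sum_filter]

/-- The map `x ↦ (ρ_j)_j` as a continuous linear map. -/
def rhoL (F : SimplexFlag V p) : (V → ℝ) →L[ℝ] (Fin (p + 1) → ℝ) :=
  ContinuousLinearMap.pi fun j =>
    ∑ i ∈ F.block j, ContinuousLinearMap.proj (R := ℝ) (φ := fun _ : V => ℝ) i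

theorem rhoL_apply (F : SimplexFlag V p) (x : V → ℝ) : F.rhoL x = F.rho x := by
  funext j
  simp [rhoL, rho]

theorem rho_pos (F : SimplexFlag V p) {x : V → ℝ} (hx : ∀ i, 0 < x i) (j : Fin (p + 1)) :
    0 < F.rho x j :=
  Finset.sum_pos (fun i _ => hx i) (Finset.card_pos.1 (F.block_card_pos j))

theorem theta_pos (F : SimplexFlag V p) {x : V → ℝ} (hx : ∀ i, 0 < x i) (i : V) :
    0 < F.theta x i :=
  div_pos (hx i) (F.rho_pos hx _)

theorem fderiv_theta (F : SimplexFlag V p) {x : V → ℝ} (hx : ∀ i, 0 < x i) (v : V → ℝ) :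
    fderiv ℝ F.theta x v = fun i => v i / F.rho x (F.blk i) -
      x i * F.rho v (F.blk i) / F.rho x (F.blk i) ^ 2 := by
  have h : HasFDerivAt F.theta (ContinuousLinearMap.pi fun i =>
      (x i • (-((F.rho x (F.blk i) ^ 2)⁻¹) • (ContinuousLinearMap.proj (R := ℝ)
          (φ := fun _ : Fin (p + 1) => ℝ) (F.blk i)).comp F.rhoL) +
        (F.rho x (F.blk i))⁻¹ • ContinuousLinearMap.proj (R := ℝ) (φ := fun _ : V => ℝ) i)) x := by
    refine hasFDerivAt_pi.2 fun i => ?_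
    have h1 := ((ContinuousLinearMap.proj (R := ℝ) (φ := fun _ : Fin (p + 1) => ℝ)
      (F.blk i)).comp F.rhoL).hasFDerivAt (x := x)
    have h2 : HasFDerivAt (fun y => (F.rho y (F.blk i))⁻¹) _ x :=
      HasDerivAt.comp_hasFDerivAt (f := fun y : V → ℝ => F.rho y (F.blk i)) x
        (hasDerivAt_inv (F.rho_pos hx (F.blk i)).ne') (h1.congr_of_eventuallyEq (.of_forall fun y => by
          simp [rhoL_apply]))
    exact (hasFDerivAt_apply i x).mul h2
  rw [h.fderiv]
  funext i
  simp [rhoL_apply]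
  field_simp
  ring

theorem prod_theta (F : SimplexFlag V p) {x : V → ℝ} (hx : ∀ i, 0 < x i) :
    (∏ i, F.theta x i) * ∏ j, F.rho x j ^ (F.deg j + 1) = ∏ i, x i := by
  rw [← prod_blk, ← Finset.prod_mul_distrib]
  refine Finset.prod_congr rfl fun i _ => ?_
  rw [theta, div_mul_cancel₀ _ (F.rho_pos hx _).ne']

theorem degree_eq (F : SimplexFlag V p) {k : ℕ} (h : Fintype.card V = k + p + 1) :
    k + p = ∑ j, F.deg j + p := by
  rw [F.sum_dim h]
  rfl

/-- The singularities of `C_F (dλ / λ)` at the boundary of the simplex are cancelled by `∏ λ_i`. -/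
theorem prod_mul_logForm_scale_inv (o : FaceOrientation V) (F : SimplexFlag V p) {k : ℕ}
    (h : Fintype.card V = k + p + 1) {x : V → ℝ} (hx : ∀ i, 0 < x i) :
    (∏ i, x i) • (F.logForm o h).compContinuousLinearMap (scale fun i => (x i)⁻¹) =
      contract (p + 1) (dLambda o Finset.univ h) (fun j => scale (F.blockVec j) x) := by
  have h2 := contract_comp (p + 1) (dLambda o Finset.univ h) (scale fun i => (x i)⁻¹)
      (fun j => scale (F.blockVec j) x)
  erw [dLambda_comp_scale] at h2
  rw [contract_smul] at h2
  have h3 : (fun j => scale (fun i => (x i)⁻¹) (scale (F.blockVec j) x)) = F.blockVec := by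
    funext j i
    have := (hx i).ne'
    simp only [scale_apply]
    field_simp
  rw [h3] at h2
  rw [logForm]
  erw [← h2]
  rw [smul_smul, ← Finset.prod_mul_distrib]
  simp [fun i => mul_inv_cancel₀ (hx i).ne']

variable [DecidableEq V]

/-- The angular form in closed form. -/
theorem angularForm_eq (o : FaceOrientation V) (F : SimplexFlag V p) {k : ℕ}
    (h : Fintype.card V = k + p + 1) {x : V → ℝ} (hx : ∀ i, 0 < x i) :
    F.angularForm o h (F.rho x) (F.theta x) =
      (F.radialSign o h * (chamberIntegral F.deg (F.rho x) * ∏ i, x i)) •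
        (F.logForm o h).compContinuousLinearMap (scale fun i => (F.theta x i)⁻¹) := by
  rw [angularForm, mul_smul]
  congr 1
  have h1 : ∀ s : Fin p → ℝ, F.fiberForm o h (radialPoint s) (F.theta x) =
      (∏ j, radialPoint s j ^ F.deg j) • (((k + p).factorial * ∏ i, F.theta x i : ℝ) •
        (F.logForm o h).compContinuousLinearMap (scale fun i => (F.theta x i)⁻¹)) := by
    intro s
    rw [fiberForm_eq o F h _ (sum_radialPoint s) _ fun i => (F.theta_pos hx i).ne', smul_smul]
    congr 1
    ring
  simp only [h1]
  rw [integral_smul_const, smul_smul]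
  congr 1
  have h2 := factorial_mul_setIntegral_region F.deg (F.rho_pos hx) (F.degree_eq h)
  rw [← F.prod_theta hx, mul_comm _ (_ * _), mul_assoc, mul_left_comm, h2]
  ring

/-- The blow-up Whitney form in closed form. The derivative of `θ` at `x` is, after division by `θ`,
division by `x` up to block vectors, which are in the kernel of `logForm`. -/
theorem psi_eq (o : FaceOrientation V) (F : SimplexFlag V p) {k : ℕ}
    (h : Fintype.card V = k + p + 1) (x : simplexInterior V) :
    F.psi o h x = (F.radialSign o h * (chamberIntegral F.deg (F.rho x) * ∏ i, (x : V → ℝ) i)) •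
      (F.logForm o h).compContinuousLinearMap
        ((scale fun i => ((x : V → ℝ) i)⁻¹).comp (tangentSpace V).subtypeL) := by
  have hx : ∀ i, 0 < (x : V → ℝ) i := x.2.1
  rw [psi, angularForm_eq o F h hx]
  ext X
  simp only [ContinuousAlternatingMap.compContinuousLinearMap_apply,
    ContinuousAlternatingMap.smul_apply, smul_eq_mul]
  congr 1
  have h1 : ∀ a, scale (fun i => (F.theta x i)⁻¹) (fderiv ℝ F.theta (x : V → ℝ) (X a)) =
      scale (fun i => ((x : V → ℝ) i)⁻¹) (X a) +
        ∑ j, (-(F.rho (X a) j / F.rho x j)) • F.blockVec j := by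
    intro a
    rw [fderiv_theta F hx, sum_smul_blockVec]
    funext i
    have h2 := (F.rho_pos hx (F.blk i)).ne'
    have h3 := (hx i).ne'
    simp only [scale_apply, theta, Pi.add_apply]
    field_simp
    ring
  have h4 := map_add_of_isKernelVector (η := F.logForm o h)
    (fun a => scale (fun i => ((x : V → ℝ) i)⁻¹) (X a))
    (fun a => ∑ j, (-(F.rho (X a) j / F.rho x j)) • F.blockVec j)
    fun a => IsKernelVector.sum_smul (fun j => F.isKernelVector_logForm o h j) _
  simp only [← h1] at h4
  exact h4

end SimplexFlag

theorem contDiffAt_smul_compContinuousLinearMap {E₀ E E' : Type*}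
    [NormedAddCommGroup E₀] [NormedSpace ℝ E₀] [NormedAddCommGroup E] [NormedSpace ℝ E]
    [NormedAddCommGroup E'] [NormedSpace ℝ E'] {k : ℕ} (f : E →L[ℝ] E') {c : E₀ → ℝ}
    {η : E₀ → E' [⋀^Fin k]→L[ℝ] ℝ} {t : E₀} (hc : ContDiffAt ℝ ∞ c t) (hη : ContDiffAt ℝ ∞ η t) :
    ContDiffAt ℝ ∞ (fun t => c t • (η t).compContinuousLinearMap f) t := by
  let L : (E' [⋀^Fin k]→L[ℝ] ℝ) →L[ℝ] (E [⋀^Fin k]→L[ℝ] ℝ) :=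
    ContinuousAlternatingMap.compContinuousLinearMapCLM f
  exact hc.smul (L.contDiff.contDiffAt.comp t hη)

theorem eventually_mem_simplexInterior {V : Type*} [Fintype V] {x : V → ℝ}
    (hx : x ∈ simplexInterior V) :
    ∀ᶠ v : tangentSpace V in nhds 0, x + (v : V → ℝ) ∈ simplexInterior V := by
  have h1 : ∀ᶠ v : tangentSpace V in nhds 0, ∀ i, 0 < x i + (v : V → ℝ) i := by
    refine Filter.eventually_all.2 fun i => ?_
    have hc : Continuous fun v : tangentSpace V => x i + (v : V → ℝ) i :=
      continuous_const.add ((continuous_apply i).comp (tangentSpace V).subtypeL.continuous)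
    refine hc.continuousAt.eventually (lt_mem_nhds ?_)
    simpa using hx.1 i
  filter_upwards [h1] with v hv
  refine ⟨hv, ?_⟩
  have h2 : ∑ i, (v : V → ℝ) i = 0 := v.2
  simp [Finset.sum_add_distrib, hx.2, h2]

theorem SimplexForm.inChart_eventuallyEq {V : Type*} [Fintype V] {k : ℕ} (α : SimplexForm V k)
    {x : V → ℝ} (hx : x ∈ simplexInterior V)
    {β : tangentSpace V → (tangentSpace V) [⋀^Fin k]→L[ℝ] ℝ}
    (hβ : ∀ (v : tangentSpace V) (hv : x + (v : V → ℝ) ∈ simplexInterior V), α ⟨_, hv⟩ = β v) :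
    α.inChart x =ᶠ[nhds 0] β := by
  filter_upwards [eventually_mem_simplexInterior hx] with v hv
  rw [inChart, dif_pos hv, hβ v hv]

namespace SimplexFlag

variable {V : Type*} {p : ℕ} [Fintype V] [DecidableEq V]

theorem smooth_psi (o : FaceOrientation V) (F : SimplexFlag V p) {k : ℕ}
    (h : Fintype.card V = k + p + 1) : (F.psi o h).Smooth := by
  intro x
  refine ContDiffAt.congr_of_eventuallyEq (f := fun v : tangentSpace V =>
    (F.radialSign o h * chamberIntegral F.deg (F.rhoL ((x : V → ℝ) + (v : V → ℝ)))) •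
    (contract (p + 1) (dLambda o Finset.univ h) (fun j =>
        scale (F.blockVec j) ((x : V → ℝ) + (v : V → ℝ)))).compContinuousLinearMap
          (tangentSpace V).subtypeL) ?_
    ((F.psi o h).inChart_eventuallyEq x.2 fun v hv => ?_)
  · have hadd : ContDiff ℝ ∞ fun v : tangentSpace V => (x : V → ℝ) + (v : V → ℝ) :=
      contDiff_const.add (tangentSpace V).subtypeL.contDiff
    have h1 : ContDiffAt ℝ ∞ (fun v : tangentSpace V => F.radialSign o h *
        chamberIntegral F.deg (F.rhoL ((x : V → ℝ) + (v : V → ℝ)))) 0 := by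
      refine contDiffAt_const.mul (ContDiffAt.comp (g := chamberIntegral F.deg) (0 : tangentSpace V)
        ?_ (F.rhoL.contDiff.comp hadd).contDiffAt)
      refine contDiffAt_chamberIntegral F.deg fun j => ?_
      rw [rhoL_apply]
      exact F.rho_pos (by simpa using x.2.1) j
    have h2 : ContDiffAt ℝ ∞ (fun v : tangentSpace V => contract (p + 1) (dLambda o Finset.univ h)
        (fun j => scale (F.blockVec j) ((x : V → ℝ) + (v : V → ℝ)))) 0 :=
      contDiffAt_contract (p + 1) contDiffAt_const fun j =>
        ((scale (F.blockVec j)).contDiff.comp hadd).contDiffAt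
    exact contDiffAt_smul_compContinuousLinearMap (tangentSpace V).subtypeL h1 h2
  · rw [psi_eq, rhoL_apply, ← prod_mul_logForm_scale_inv o F h hv.1, ← mul_assoc, mul_smul]
    rfl

end SimplexFlag

/-! ### The exterior derivative in logarithmic coordinates -/

theorem extDeriv_fun_smul_const {E : Type*} [NormedAddCommGroup E] [NormedSpace ℝ E] {k : ℕ}
    {g : E → ℝ} {y : E} (hg : DifferentiableAt ℝ g y) (C : E [⋀^Fin k]→L[ℝ] ℝ) :
    extDeriv (fun y => g y • C) y =
      ContinuousAlternatingMap.alternatizeUncurryFin ((fderiv ℝ g y).smulRight C) := by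
  rw [extDeriv, (hg.hasFDerivAt.smul_const C).fderiv]

theorem dLambda_cast {V : Type*} [Fintype V] (o : FaceOrientation V) {N N' : ℕ}
    (h : (Finset.univ : Finset V).card = N) (h' : (Finset.univ : Finset V).card = N') (e : N' = N)
    (v : Fin N → V → ℝ) :
    dLambda o Finset.univ h v = dLambda o Finset.univ h' fun a => v (Fin.cast e a) := by
  subst e
  rfl

/-- A form of degree greater than the dimension vanishes. -/
theorem eq_zero_of_card_lt {V : Type*} [Fintype V] {N : ℕ} (hN : Fintype.card V < N)
    (W : (V → ℝ) [⋀^Fin N]→L[ℝ] ℝ) : W = 0 := by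
  ext v
  refine W.toAlternatingMap.map_linearDependent v fun hli => ?_
  have := hli.fintype_card_le_finrank
  rw [Module.finrank_fintype_fun_eq_card, Fintype.card_fin] at this
  omega

namespace SimplexFlag

variable {V : Type*} {p : ℕ} [Fintype V]

/-- Expansion of `ℓ ∧ dλ_V (1_{V_0}, …, 1_{V_p}, ·)`: the contraction of the vanishing form
`ℓ ∧ dλ_V` with the block vectors is zero. -/
theorem wedge_logForm (o : FaceOrientation V) (F : SimplexFlag V p) {k : ℕ}
    (h : Fintype.card V = k + p + 1) (h' : (Finset.univ : Finset V).card = k + 1 + p)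
    (l : (V → ℝ) →L[ℝ] ℝ) :
    ContinuousAlternatingMap.alternatizeUncurryFin (l.smulRight (F.logForm o h)) =
      ((-1) ^ p : ℝ) • ∑ j : Fin (p + 1), ((-1) ^ j.val * l (F.blockVec j)) •
        contract p (dLambda o Finset.univ h') (fun i => F.blockVec (j.succAbove i)) := by
  have hW : (0 : (V → ℝ) [⋀^Fin (k + 1 + (p + 1))]→L[ℝ] ℝ) =
      ContinuousAlternatingMap.alternatizeUncurryFin (l.smulRight (dLambda o Finset.univ h')) :=
    (eq_zero_of_card_lt (by omega) _).symm
  have h1 := contract_wedge p l (dLambda o Finset.univ h') (dLambda o Finset.univ h) 0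
    (fun v => dLambda_cast o h' h (by omega) v)
    (fun v => by
      rw [hW]
      refine (ContinuousAlternatingMap.alternatizeUncurryFin_apply _ _).trans
        (Finset.sum_congr rfl fun a _ => ?_)
      simp)
    F.blockVec
  rw [contract_zero] at h1
  ext w
  have h2 := congrArg (fun η => η w) h1
  have h0 : (0 : (V → ℝ) [⋀^Fin (k + 1)]→L[ℝ] ℝ) w = 0 := rfl
  simp only [h0, ContinuousAlternatingMap.add_apply,
    ContinuousAlternatingMap.smul_apply, smul_eq_mul] at h2 ⊢
  have h3 : ((-1 : ℝ) ^ p) * (-1) ^ p = 1 := by rw [← mul_pow]; simp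
  rw [pow_succ] at h2
  change ContinuousAlternatingMap.alternatizeUncurryFin
    (l.smulRight (contract (p + 1) (dLambda o Finset.univ h) F.blockVec)) w = _
  linear_combination (-1 : ℝ) * ContinuousAlternatingMap.alternatizeUncurryFin
    (l.smulRight (contract (p + 1) (dLambda o Finset.univ h) F.blockVec)) w * h3 +
      (-1) ^ p * h2

/-- The coefficient of `ψ_F` in logarithmic coordinates `y_i = log λ_i`. -/
def potential (F : SimplexFlag V p) (y : V → ℝ) : ℝ :=
  chamberIntegral F.deg (F.rho fun i => Real.exp (y i)) * Real.exp (∑ i, y i)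

/-- The logarithmic derivatives of `G ∏ λ_i` along the blocks are the expressions to which
integration by parts applies. -/
theorem hasFDerivAt_potential (F : SimplexFlag V p) (y : V → ℝ) :
    ∃ l : (V → ℝ) →L[ℝ] ℝ, HasFDerivAt F.potential l y ∧
      ∀ j, l (F.blockVec j) = Real.exp (∑ i, y i) *
        (((F.deg j : ℝ) + 1) * chamberIntegral F.deg (F.rho fun i => Real.exp (y i)) -
          F.rho (fun i => Real.exp (y i)) j *
            laplace (tail (F.rho fun i => Real.exp (y i))) (partialSum j * chamberPoly F.deg)) := by
  set x : V → ℝ := fun i => Real.exp (y i) with hx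
  have hexp : HasFDerivAt (fun (y : V → ℝ) i => Real.exp (y i)) (scale x) y := by
    refine hasFDerivAt_pi.2 fun i => ?_
    exact (hasFDerivAt_apply i y).exp
  have hrho : HasFDerivAt (fun y : V → ℝ => F.rho fun i => Real.exp (y i)) (F.rhoL.comp (scale x)) y := by
    have := F.rhoL.hasFDerivAt.comp y hexp
    simpa only [Function.comp_def, rhoL_apply] using this
  have hG := (hasFDerivAt_chamberIntegral F.deg (F.rho_pos (x := x) fun i => Real.exp_pos _)).comp y
    hrho
  have hS : HasFDerivAt (fun y : V → ℝ => Real.exp (∑ i, y i)) _ y :=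
    (HasFDerivAt.fun_sum (u := Finset.univ) fun i _ => hasFDerivAt_apply i y).exp
  refine ⟨_, hG.mul hS, fun j => ?_⟩
  have h1 : ∑ i, F.blockVec j i = (F.deg j : ℝ) + 1 := by
    have : ((F.deg j + 1 : ℕ) : ℝ) = ((F.block j).card : ℝ) := by rw [deg_add_one]
    push_cast at this
    rw [this]
    simp [blockVec, block]
  have h2 : ∀ j', F.rho (scale x (F.blockVec j)) j' = if j' = j then F.rho x j else 0 := by
    intro j'
    rw [rho_eq_sum_blockVec]
    split_ifs with hj
    · subst hj
      rw [rho_eq_sum_blockVec]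
      refine Finset.sum_congr rfl fun i _ => ?_
      simp only [scale_apply, blockVec]
      split_ifs <;> simp
    · refine Finset.sum_eq_zero fun i _ => ?_
      simp only [scale_apply, blockVec]
      split_ifs with h1 h2 <;> simp
      exact absurd (h1.symm.trans h2) hj
  simp only [Function.comp_apply, add_apply, smul_apply, ContinuousLinearMap.comp_apply,
    sum_apply, ContinuousLinearMap.proj_apply, smul_eq_mul, rhoL_apply, h1, h2, mul_ite, mul_zero,
    Finset.sum_ite_eq', Finset.mem_univ, if_true]
  ring

end SimplexFlag

/-- Pullback of the exterior derivative under the logarithm `v ↦ log (x + v)`. -/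
theorem extDeriv_log_pullback {V : Type*} [Fintype V] {E : Type*} [NormedAddCommGroup E]
    [NormedSpace ℝ E] {k : ℕ} (e : E →L[ℝ] (V → ℝ)) {x : V → ℝ} (hx : ∀ i, 0 < x i)
    {β : (V → ℝ) → (V → ℝ) [⋀^Fin k]→L[ℝ] ℝ}
    (hβ : DifferentiableAt ℝ β fun i => Real.log (x i)) :
    extDeriv (fun v => (β fun i => Real.log (x i + e v i)).compContinuousLinearMap
      ((scale fun i => (x i + e v i)⁻¹).comp e)) 0 =
    (extDeriv β fun i => Real.log (x i)).compContinuousLinearMap ((scale fun i => (x i)⁻¹).comp e) := by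
  have hev : ∀ᶠ v in nhds (0 : E), ∀ i, 0 < x i + e v i := by
    refine Filter.eventually_all.2 fun i => ?_
    have hc : Continuous fun v : E => x i + e v i :=
      continuous_const.add ((continuous_apply i).comp e.continuous)
    refine hc.continuousAt.eventually (lt_mem_nhds ?_)
    simpa using hx i
  have hadd : ∀ i, ContDiff ℝ 2 fun v : E => x i + e v i := fun i =>
    contDiff_const.add
      ((ContinuousLinearMap.proj (R := ℝ) (φ := fun _ : V => ℝ) i).comp e).contDiff
  set f : E → V → ℝ := fun v i => Real.log (x i + e v i) with hf
  have hfd : ∀ v, (∀ i, 0 < x i + e v i) →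
      HasFDerivAt f ((scale fun i => (x i + e v i)⁻¹).comp e) v := by
    intro v hv
    refine hasFDerivAt_pi'.2 fun i => ?_
    have h1 : HasFDerivAt (fun v => x i + e v i)
        ((ContinuousLinearMap.proj (R := ℝ) (φ := fun _ : V => ℝ) i).comp e) v :=
      ((ContinuousLinearMap.proj (R := ℝ) (φ := fun _ : V => ℝ) i).comp e).hasFDerivAt.const_add _
    exact h1.log (hv i).ne'
  have h0 : ∀ i, x i + e 0 i = x i := fun i => by simp
  have hf0 : f 0 = fun i => Real.log (x i) := by
    funext i
    simp only [hf, h0]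
  have hfsm : ContDiffAt ℝ 2 f 0 := by
    have h2 : ∀ i, ContDiffAt ℝ 2 (fun v => f v i) 0 := fun i =>
      (hadd i).contDiffAt.log (by rw [h0]; exact (hx i).ne')
    exact contDiffAt_pi.2 h2
  have h1 := extDeriv_pullback (r := 2) (f := f) (x := 0) (by rw [hf0]; exact hβ) hfsm (by simp)
  rw [(hfd 0 fun i => by rw [h0]; exact hx i).fderiv, hf0] at h1
  simp only [h0] at h1
  rw [← h1]
  refine Filter.EventuallyEq.extDeriv_eq ?_
  filter_upwards [hev] with v hv
  rw [(hfd v hv).fderiv]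

namespace SimplexFlag

variable {V : Type*} {p : ℕ} [Fintype V] [DecidableEq V]

/-- Near `x`, the form `ψ_F` is the pullback under the logarithm of a function times a constant
form. -/
theorem d_psi_eq (o : FaceOrientation V) (F : SimplexFlag V p) {k : ℕ}
    (h : Fintype.card V = k + p + 1) (x : simplexInterior V) :
    (F.psi o h).d x = F.radialSign o h • (ContinuousAlternatingMap.alternatizeUncurryFin
      ((fderiv ℝ F.potential fun i => Real.log ((x : V → ℝ) i)).smulRight
        (F.logForm o h))).compContinuousLinearMap
          ((scale fun i => ((x : V → ℝ) i)⁻¹).comp (tangentSpace V).subtypeL) := by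
  obtain ⟨l, hl, -⟩ := F.hasFDerivAt_potential fun i => Real.log ((x : V → ℝ) i)
  have hc : (F.psi o h).inChart x =ᶠ[nhds 0] F.radialSign o h • fun v : tangentSpace V =>
      ((fun y => F.potential y • F.logForm o h) fun i =>
        Real.log ((x : V → ℝ) i + (tangentSpace V).subtypeL v i)).compContinuousLinearMap
      ((scale fun i => ((x : V → ℝ) i + (tangentSpace V).subtypeL v i)⁻¹).comp
        (tangentSpace V).subtypeL) := by
    refine (F.psi o h).inChart_eventuallyEq x.2 fun v hv => ?_
    rw [psi_eq]
    have h1 : ∀ i, Real.exp (Real.log ((x : V → ℝ) i + (v : V → ℝ) i)) =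
        (x : V → ℝ) i + (v : V → ℝ) i := fun i => Real.exp_log (hv.1 i)
    simp only [Pi.smul_apply, potential, Submodule.subtypeL_apply, h1, Real.exp_sum, mul_smul]
    rfl
  rw [SimplexForm.d, hc.extDeriv_eq, extDeriv_smul,
    extDeriv_log_pullback (tangentSpace V).subtypeL x.2.1 (hl.differentiableAt.smul_const _),
    extDeriv_fun_smul_const hl.differentiableAt]

end SimplexFlag

/-! ### Merging two blocks -/

/-- Summation by parts for an alternating sum. -/
theorem sum_neg_one_pow_by_parts {M : Type*} [AddCommGroup M] [Module ℝ M] {q : ℕ}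
    (B H : Fin (q + 2) → ℝ) (c : Fin (q + 2) → M) (h0 : B 0 = 0)
    (hH : ∀ j : Fin (q + 1), H j.castSucc = B j.succ - B j.castSucc)
    (hlast : H (Fin.last (q + 1)) = -B (Fin.last (q + 1))) :
    ∑ i, ((-1) ^ i.val * H i) • c i =
      ∑ j : Fin (q + 1), ((-1) ^ j.val * B j.succ) • (c j.castSucc + c j.succ) := by
  have h1 : ∑ i, ((-1) ^ i.val * B i) • c i =
      -∑ j : Fin (q + 1), ((-1) ^ j.val * B j.succ) • c j.succ := by
    rw [Fin.sum_univ_succ, h0, mul_zero, zero_smul, zero_add, ← Finset.sum_neg_distrib]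
    refine Finset.sum_congr rfl fun j _ => ?_
    rw [← neg_smul, Fin.val_succ, pow_succ]
    congr 1
    ring
  have h2 : ∑ i, ((-1) ^ i.val * (H i + B i)) • c i =
      ∑ j : Fin (q + 1), ((-1) ^ j.val * B j.succ) • c j.castSucc := by
    rw [Fin.sum_univ_castSucc, hlast, neg_add_cancel, mul_zero, zero_smul, add_zero]
    refine Finset.sum_congr rfl fun j _ => ?_
    rw [hH, sub_add_cancel, Fin.val_castSucc]
  simp only [mul_add, add_smul, Finset.sum_add_distrib, smul_add] at h2 ⊢
  rw [h1] at h2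
  rw [← h2]
  abel

namespace SimplexFlag

variable {V : Type*}

theorem blockVec_merge {q : ℕ} (F : SimplexFlag V (q + 1)) (j i : Fin (q + 1)) :
    (F.merge j).blockVec i =
      F.blockVec (j.succ.succAbove i) + if i = j then F.blockVec j.succ else 0 := by
  funext v
  have h : (F.merge j).blk v = i ↔
      F.blk v = j.succ.succAbove i ∨ (i = j ∧ F.blk v = j.succ) := by
    change j.predAbove (F.blk v) = i ↔ _
    simp only [Fin.ext_iff, val_predAbove, val_succAbove, Fin.val_succ]
    split_ifs <;> omega
  have h' : F.blk v = j.succ.succAbove i → F.blk v ≠ j.succ := by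
    intro h1 h2
    exact Fin.succAbove_ne j.succ i (h1.symm.trans h2)
  have hb : F.blockVec j.succ v = if F.blk v = j.succ then 1 else 0 := rfl
  simp only [blockVec, Pi.add_apply]
  by_cases hij : i = j
  · by_cases h1 : F.blk v = j.succ.succAbove i
    · rw [if_pos (h.2 (Or.inl h1)), if_pos h1, if_pos hij, hb, if_neg (h' h1), add_zero]
    · rw [if_neg h1, if_pos hij, hb]
      by_cases h2 : F.blk v = j.succ
      · rw [if_pos (h.2 (Or.inr ⟨hij, h2⟩)), if_pos h2, zero_add]
      · rw [if_neg (fun h3 => (h.1 h3).elim h1 fun h4 => h2 h4.2), if_neg h2, zero_add]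
  · simp [h, hij]

variable [Fintype V]

theorem rho_merge {q : ℕ} (F : SimplexFlag V (q + 1)) (x : V → ℝ) (j i : Fin (q + 1)) :
    (F.merge j).rho x i =
      F.rho x (j.succ.succAbove i) + if i = j then F.rho x j.succ else 0 := by
  simp only [rho_eq_sum_blockVec, blockVec_merge, Pi.add_apply, add_mul, Finset.sum_add_distrib]
  split_ifs <;> simp

theorem deg_merge {q : ℕ} (F : SimplexFlag V (q + 1)) (j i : Fin (q + 1)) :
    (F.merge j).deg i =
      F.deg (j.succ.succAbove i) + if i = j then F.deg j.succ + 1 else 0 := by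
  have h1 : ∀ {p : ℕ} (F : SimplexFlag V p) (i : Fin (p + 1)),
      F.rho (fun _ => 1) i = (F.deg i : ℝ) + 1 := by
    intro p F i
    have : ((F.deg i + 1 : ℕ) : ℝ) = ((F.block i).card : ℝ) := by rw [deg_add_one]
    push_cast at this
    rw [this]
    simp [rho]
  have h2 := rho_merge F (fun _ => 1) j i
  simp only [h1] at h2
  have h3 : (((F.merge j).deg i : ℕ) : ℝ) =
      ((F.deg (j.succ.succAbove i) + if i = j then F.deg j.succ + 1 else 0 : ℕ) : ℝ) := by
    split_ifs at h2 ⊢ <;> push_cast <;> linarith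
  exact_mod_cast h3

/-- The form of the merged flag is a sum of two contractions, because `1_{V_j ∪ V_{j+1}}` is the sum
of `1_{V_j}` and `1_{V_{j+1}}`. -/
theorem logForm_merge (o : FaceOrientation V) {q k : ℕ} (F : SimplexFlag V (q + 1))
    (h' : Fintype.card V = k + 1 + q + 1) (j : Fin (q + 1)) :
    (F.merge j).logForm o h' =
      contract (q + 1) (dLambda (N := k + 1 + (q + 1)) o Finset.univ h')
        (fun i => F.blockVec (j.castSucc.succAbove i)) +
      contract (q + 1) (dLambda (N := k + 1 + (q + 1)) o Finset.univ h')
        (fun i => F.blockVec (j.succ.succAbove i)) := by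
  refine contract_add_slot (q + 1) _ j _ _ _ (fun i hi => ?_) (fun i hi => ?_) ?_
  · rw [blockVec_merge, if_neg hi, add_zero]
    congr 1
    rw [Fin.ext_iff, val_succAbove, val_succAbove, Fin.val_succ, Fin.val_castSucc]
    have : i.val ≠ j.val := fun h => hi (Fin.ext h)
    split_ifs <;> omega
  · rw [blockVec_merge, if_neg hi, add_zero]
  · rw [blockVec_merge, if_pos rfl, add_comm, Fin.succAbove_castSucc_self]

variable [DecidableEq V]

/-- The exterior derivative of `ψ_F`, up to the signs that come from the orientations. -/
theorem d_psi_eq_sum (o : FaceOrientation V) {q k : ℕ} (F : SimplexFlag V (q + 1))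
    (h : Fintype.card V = k + (q + 1) + 1) (h' : Fintype.card V = k + 1 + q + 1)
    (x : simplexInterior V) :
    (F.psi o h).d x = ∑ j : Fin (q + 1), (F.radialSign o h * ((-1) ^ (q + 1) * (-1) ^ j.val) *
      (chamberIntegral (F.merge j).deg ((F.merge j).rho x) * ∏ i, (x : V → ℝ) i)) •
        ((F.merge j).logForm o h').compContinuousLinearMap
          ((scale fun i => ((x : V → ℝ) i)⁻¹).comp (tangentSpace V).subtypeL) := by
  obtain ⟨l, hl, hl'⟩ := F.hasFDerivAt_potential fun i => Real.log ((x : V → ℝ) i)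
  have hx : ∀ i, 0 < (x : V → ℝ) i := x.2.1
  have hexp : (fun i => Real.exp (Real.log ((x : V → ℝ) i))) = (x : V → ℝ) :=
    funext fun i => Real.exp_log (hx i)
  have hprod : Real.exp (∑ i, Real.log ((x : V → ℝ) i)) = ∏ i, (x : V → ℝ) i := by
    rw [Real.exp_sum]
    exact Finset.prod_congr rfl fun i _ => Real.exp_log (hx i)
  rw [hexp, hprod] at hl'
  have hN : (Finset.univ : Finset V).card = k + 1 + (q + 1) := h'
  have hρ := F.rho_pos hx
  have hparts := sum_neg_one_pow_by_parts
    (fun i => (∏ i, (x : V → ℝ) i) * wallIntegral F.deg (F.rho x) i)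
    (fun i => l (F.blockVec i))
    (fun j => contract (q + 1) (dLambda o Finset.univ hN) fun i => F.blockVec (j.succAbove i))
    (by simp only [wallIntegral_zero, mul_zero])
    (fun j => by simp only [hl', chamberIntegral_castSucc F.deg hρ, mul_sub])
    (by simp only [hl', chamberIntegral_last F.deg hρ, mul_neg])
  have hwedge := wedge_logForm o F h hN l
  rw [d_psi_eq, hl.fderiv, hwedge.trans (congrArg (fun η => ((-1) ^ (q + 1) : ℝ) • η) hparts)]
  ext w
  simp only [ContinuousAlternatingMap.smul_apply, ContinuousAlternatingMap.sum_apply,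
    ContinuousAlternatingMap.compContinuousLinearMap_apply, smul_eq_mul, Finset.mul_sum,
    logForm_merge]
  refine Finset.sum_congr rfl fun j _ => ?_
  rw [wallIntegral_succ F.deg (F.rho x) j (F.merge j).deg ((F.merge j).rho x)
    (fun i => F.deg_merge j i) (fun i => F.rho_merge x j i)]
  ring

/-- A top-dimensional form `ψ_F` is closed: the only boundary terms are those at `u_0 = 0` and at
infinity, and both vanish. -/
theorem d_psi_zero (o : FaceOrientation V) {k : ℕ} (F : SimplexFlag V 0)
    (h : Fintype.card V = k + 0 + 1) : (F.psi o h).d = 0 := by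
  funext x
  obtain ⟨l, hl, hl'⟩ := F.hasFDerivAt_potential fun i => Real.log ((x : V → ℝ) i)
  have hx : ∀ i, 0 < (x : V → ℝ) i := x.2.1
  have hexp : (fun i => Real.exp (Real.log ((x : V → ℝ) i))) = (x : V → ℝ) :=
    funext fun i => Real.exp_log (hx i)
  have hlast := chamberIntegral_last F.deg (F.rho_pos hx)
  have h0 : l (F.blockVec 0) = 0 := by
    rw [hl', hexp]
    have : (Fin.last 0) = 0 := rfl
    rw [this, wallIntegral_zero] at hlast
    rw [hlast]
    simp
  rw [d_psi_eq, hl.fderiv, wedge_logForm o F h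
    (show (Finset.univ : Finset V).card = k + 1 + 0 by rw [Finset.card_univ]; omega) l]
  ext w
  simp only [Fin.sum_univ_succ, h0, Fin.sum_univ_zero]
  simp

end SimplexFlag

/-! ### Signs and orientations -/

/-- The contraction evaluated as a form: the vectors `v` fill the first slots. -/
theorem contract_apply {E : Type*} [NormedAddCommGroup E] [NormedSpace ℝ E] {k : ℕ} (p : ℕ)
    (η : E [⋀^Fin (k + p)]→L[ℝ] ℝ) (v : Fin p → E) (w : Fin k → E) :
    contract p η v w = η fun a => Fin.append v w (Fin.cast (Nat.add_comm k p) a) := by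
  induction p with
  | zero =>
    rw [contract]
    congr 1
    funext a
    have : Fin.cast (Nat.add_comm k 0) a = Fin.natAdd 0 a := Fin.ext (by simp)
    rw [this, Fin.append_right]
  | succ p ih =>
    rw [contract, ih]
    change η (Matrix.vecCons (v 0) _) = _
    congr 1
    funext a
    refine Fin.cases ?_ (fun a => ?_) a
    · have : Fin.cast (Nat.add_comm k (p + 1)) (0 : Fin (k + p + 1)) = Fin.castAdd k 0 :=
        Fin.ext (by simp)
      erw [this, Fin.append_left]
      rfl
    · rw [Matrix.cons_val_succ]
      by_cases ha : a.val < p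
      · have h1 : Fin.cast (Nat.add_comm k p) a = Fin.castAdd k ⟨a.val, ha⟩ := Fin.ext (by simp)
        have h2 : Fin.cast (Nat.add_comm k (p + 1)) (a.succ : Fin (k + p + 1)) =
            Fin.castAdd k (Fin.succ ⟨a.val, ha⟩) := Fin.ext (by simp)
        rw [h1, Fin.append_left]
        erw [h2, Fin.append_left]
      · have hk : a.val - p < k := by
          have : a.val < k + p := a.isLt
          omega
        have h1 : Fin.cast (Nat.add_comm k p) a = Fin.natAdd p ⟨a.val - p, hk⟩ :=
          Fin.ext (by simp; omega)
        have h2 : Fin.cast (Nat.add_comm k (p + 1)) (a.succ : Fin (k + p + 1)) =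
            Fin.natAdd (p + 1) ⟨a.val - p, hk⟩ := Fin.ext (by simp; omega)
        rw [h1, Fin.append_right]
        erw [h2, Fin.append_right]

theorem dLambda_ne_zero {V : Type*} [Fintype V] (o : FaceOrientation V) {N : ℕ}
    (h : (Finset.univ : Finset V).card = N) {v : Fin N → V → ℝ} (hv : LinearIndependent ℝ v) :
    dLambda o Finset.univ h v ≠ 0 := by
  rw [dLambda_apply]
  have h1 : Function.Surjective fun b : Fin N => (o Finset.univ (Fin.cast h.symm b) : V) := by
    intro i
    refine ⟨Fin.cast h ((o Finset.univ).symm ⟨i, Finset.mem_univ i⟩), ?_⟩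
    change ((o Finset.univ ((o Finset.univ).symm ⟨i, Finset.mem_univ i⟩) : Finset.univ) : V) = i
    rw [Equiv.apply_symm_apply]
  have h2 : LinearIndependent ℝ
      (Matrix.of fun a b => v a (o Finset.univ (Fin.cast h.symm b) : V)).row := by
    refine hv.map' (LinearMap.funLeft ℝ ℝ fun b : Fin N => (o Finset.univ (Fin.cast h.symm b) : V)) ?_
    exact LinearMap.ker_eq_bot.2 (LinearMap.funLeft_injective_of_surjective ℝ ℝ _ h1)
  exact (((Matrix.isUnit_iff_isUnit_det _).1
    (Matrix.linearIndependent_rows_iff_isUnit.1 h2))).ne_zero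

/-- Two orientations of `T` define forms that differ by a sign. -/
theorem dLambda_eq_smul {V : Type*} [Fintype V] (o o' : FaceOrientation V) {N : ℕ}
    (h : (Finset.univ : Finset V).card = N) :
    ∃ c : ℝ, (c = 1 ∨ c = -1) ∧ dLambda o' Finset.univ h = c • dLambda o Finset.univ h := by
  let σ : Equiv.Perm (Fin N) :=
    (finCongr h.symm).trans ((o' Finset.univ).trans ((o Finset.univ).symm.trans (finCongr h)))
  refine ⟨((Equiv.Perm.sign σ : ℤ) : ℝ), ?_, ?_⟩
  · rcases Int.units_eq_one_or (Equiv.Perm.sign σ) with hs | hs <;> simp [hs]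
  · ext v
    rw [ContinuousAlternatingMap.smul_apply, dLambda_apply, dLambda_apply, smul_eq_mul,
      ← Matrix.det_permute']
    congr 1
    funext a b
    change _ = v a (o Finset.univ ((o Finset.univ).symm (o' Finset.univ (Fin.cast h.symm b))) : V)
    rw [Equiv.apply_symm_apply]
    rfl

/-- Permuting the coordinates of `ℝ^V` multiplies `dλ_V` by the sign of the permutation. -/
theorem dLambda_comp_perm {V : Type*} [Fintype V] [DecidableEq V] (o : FaceOrientation V) {N : ℕ}
    (h : (Finset.univ : Finset V).card = N) (τ : Equiv.Perm V) (v : Fin N → V → ℝ) :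
    dLambda o Finset.univ h (fun a i => v a (τ i)) =
      ((Equiv.Perm.sign τ : ℤ) : ℝ) * dLambda o Finset.univ h v := by
  let e : Fin N ≃ V := (finCongr h.symm).trans ((o Finset.univ).trans
      (Equiv.subtypeUnivEquiv fun x => Finset.mem_univ x))
  rw [dLambda_apply, dLambda_apply, ← Equiv.Perm.sign_permCongr e.symm τ, ← Matrix.det_permute']
  congr 1
  funext a b
  change _ = v a (e (e.symm (τ (e b))))
  rw [Equiv.apply_symm_apply]
  rfl

namespace SimplexFlag

variable {V : Type*} {p : ℕ} [Fintype V]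

/-- The block of the `a`-th vector `e_{i_l} - e_{i_0}` of `thetaFrame`, and the number `l - 1`. -/
def frameIndex (F : SimplexFlag V p) {k : ℕ} (h : Fintype.card V = k + p + 1) :
    Fin k ≃ Σ j : Fin (p + 1), Fin ((F.block j).card - 1) :=
  (finCongr (F.sum_dim h)).trans finSigmaFinEquiv.symm

/-- The first vertex `i_0` of the block `V_j`. -/
def root (o : FaceOrientation V) (F : SimplexFlag V p) (j : Fin (p + 1)) : V :=
  o (F.block j) ⟨0, F.block_card_pos j⟩

/-- The vertices `i_1, …, i_m` of the blocks `V_j` that are not the first of their block. -/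
def head (o : FaceOrientation V) (F : SimplexFlag V p)
    (s : Σ j : Fin (p + 1), Fin ((F.block j).card - 1)) : V :=
  o (F.block s.1) ⟨s.2 + 1, by have := s.2.isLt; omega⟩

theorem thetaFrame_eq [DecidableEq V] (o : FaceOrientation V) (F : SimplexFlag V p) {k : ℕ}
    (h : Fintype.card V = k + p + 1) (a : Fin k) : F.thetaFrame o h a =
      Pi.single (F.head o (F.frameIndex h a)) 1 - Pi.single (F.root o (F.frameIndex h a).1) 1 := rfl

theorem blk_of_block (o : FaceOrientation V) (F : SimplexFlag V p) (j : Fin (p + 1))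
    (b : Fin (F.block j).card) : F.blk (o (F.block j) b) = j :=
  (Finset.mem_filter.1 (o (F.block j) b).2).2

theorem blk_root (o : FaceOrientation V) (F : SimplexFlag V p) (j : Fin (p + 1)) :
    F.blk (F.root o j) = j :=
  F.blk_of_block o j _

theorem blk_head (o : FaceOrientation V) (F : SimplexFlag V p)
    (s : Σ j : Fin (p + 1), Fin ((F.block j).card - 1)) : F.blk (F.head o s) = s.1 :=
  F.blk_of_block o s.1 _

theorem head_injective (o : FaceOrientation V) (F : SimplexFlag V p) :
    Function.Injective (F.head o) := by
  rintro ⟨j, l⟩ ⟨j', l'⟩ h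
  obtain rfl : j = j' := by
    have := congrArg F.blk h
    rwa [blk_head, blk_head] at this
  have h2 := (o (F.block j)).injective (Subtype.ext h)
  simp only [Fin.mk.injEq, Nat.add_right_cancel_iff] at h2
  rw [Fin.ext h2]

theorem head_ne_root (o : FaceOrientation V) (F : SimplexFlag V p)
    (s : Σ j : Fin (p + 1), Fin ((F.block j).card - 1)) (j : Fin (p + 1)) :
    F.head o s ≠ F.root o j := by
  intro h
  obtain ⟨j', l⟩ := s
  obtain rfl : j' = j := by
    have := congrArg F.blk h
    rwa [blk_head, blk_root] at this
  have h2 := (o (F.block j')).injective (Subtype.ext h)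
  simp at h2

variable [DecidableEq V]

theorem rho_thetaFrame (o : FaceOrientation V) (F : SimplexFlag V p) {k : ℕ}
    (h : Fintype.card V = k + p + 1) (a : Fin k) (j : Fin (p + 1)) :
    F.rho (F.thetaFrame o h a) j = 0 := by
  rw [rho_eq_sum_blockVec, thetaFrame_eq]
  simp only [Pi.sub_apply, mul_sub, Finset.sum_sub_distrib, Pi.single_apply, mul_ite, mul_one,
    mul_zero, Finset.sum_ite_eq', Finset.mem_univ, if_true]
  rw [blockVec, blockVec, blk_head, blk_root, sub_self]

/-- The block vectors and the frame of `Θ` form a basis of `ℝ^V`. -/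
theorem linearIndependent_blockVec_thetaFrame (o : FaceOrientation V) (F : SimplexFlag V p) {k : ℕ}
    (h : Fintype.card V = k + p + 1) :
    LinearIndependent ℝ (Sum.elim F.blockVec (F.thetaFrame o h)) := by
  rw [Fintype.linearIndependent_iff]
  intro g hg
  rw [Fintype.sum_sum_type] at hg
  simp only [Sum.elim_inl, Sum.elim_inr] at hg
  have hinl : ∀ j, g (Sum.inl j) = 0 := by
    intro j
    have h1 := congrFun (congrArg F.rhoL hg) j
    rw [map_add, map_sum, map_sum, map_zero] at h1
    simp only [map_smul, Pi.add_apply, Finset.sum_apply, Pi.smul_apply, rhoL_apply, rho_thetaFrame,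
      Pi.zero_apply, smul_eq_mul] at h1
    simp only [mul_zero, Finset.sum_const_zero, add_zero] at h1
    have h2 : ∀ j', F.rho (F.blockVec j') j = if j' = j then ((F.block j).card : ℝ) else 0 := by
      intro j'
      rw [rho, Finset.sum_congr rfl fun i hi => by
        rw [blockVec, (Finset.mem_filter.1 hi).2]]
      simp [eq_comm]
    simp only [h2, mul_ite, mul_zero, Finset.sum_ite_eq', Finset.mem_univ, if_true] at h1
    have h3 : ((F.block j).card : ℝ) ≠ 0 := by
      have := F.block_card_pos j
      positivity
    exact (mul_eq_zero.1 h1).resolve_right h3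
  simp only [hinl, zero_smul, Finset.sum_const_zero, zero_add] at hg
  rintro (j | a)
  · exact hinl j
  · have h1 := congrFun hg (F.head o (F.frameIndex h a))
    simp only [Finset.sum_apply, Pi.smul_apply, thetaFrame_eq, Pi.sub_apply, Pi.single_apply,
      (F.head_injective o).eq_iff, (F.frameIndex h).injective.eq_iff, F.head_ne_root o, if_false, sub_zero,
      smul_eq_mul, mul_ite, mul_one, mul_zero, Pi.zero_apply, Finset.sum_ite_eq, Finset.mem_univ,
      if_true] at h1
    exact h1

/-- The orientation of `R` is well defined: `logForm` does not vanish on the frame of `Θ`. -/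
theorem logForm_thetaFrame_ne_zero (o o' : FaceOrientation V) (F : SimplexFlag V p) {k : ℕ}
    (h : Fintype.card V = k + p + 1) : F.logForm o h (F.thetaFrame o' h) ≠ 0 := by
  rw [logForm, contract_apply]
  refine dLambda_ne_zero o _ ?_
  have h1 : (fun a : Fin (k + (p + 1)) => Fin.append F.blockVec (F.thetaFrame o' h)
      (Fin.cast (Nat.add_comm k (p + 1)) a)) =
      Sum.elim F.blockVec (F.thetaFrame o' h) ∘
        ((finCongr (Nat.add_comm k (p + 1))).trans finSumFinEquiv.symm) := by
    funext a
    have h2 : Fin.append F.blockVec (F.thetaFrame o' h) =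
        Sum.elim F.blockVec (F.thetaFrame o' h) ∘ finSumFinEquiv.symm := by
      rw [Equiv.eq_comp_symm, ← Fin.append_comp_sumElim]
      funext s
      rcases s with s | s <;> rfl
    rw [h2]
    rfl
  rw [h1]
  exact (F.linearIndependent_blockVec_thetaFrame o' h).comp _ (Equiv.injective _)

/-- The sign of the radial orientation is the sign of `logForm` on the frame of `Θ`. -/
theorem radialSign_eq (o : FaceOrientation V) (F : SimplexFlag V p) {k : ℕ}
    (h : Fintype.card V = k + p + 1) :
    F.radialSign o h = Real.sign (F.logForm o h (F.thetaFrame o h)) := by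
  have hp : ((p : ℝ) + 1) ≠ 0 := by positivity
  have hpos : ∀ i, 0 < F.theta (fun _ => 1) i := F.theta_pos fun _ => one_pos
  rw [radialSign, fiberForm_eq o F h _ (by simp [mul_inv_cancel₀ hp]) _ fun i => (hpos i).ne',
    ContinuousAlternatingMap.smul_apply, ContinuousAlternatingMap.compContinuousLinearMap_apply]
  have h1 : (fun i => (F.theta (fun _ => 1) i)⁻¹) = fun i => F.rho (fun _ => 1) (F.blk i) := by
    funext i
    simp [theta]
  rw [h1]
  have h2 := F.logForm_scale o h (F.rho fun _ => 1) (F.thetaFrame o h)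
  simp only [Function.comp_def]
  rw [h2, smul_eq_mul, ← mul_assoc]
  have h3 : ∀ c r : ℝ, 0 < c → Real.sign (c * r) = Real.sign r := by
    intro c r hc
    rcases lt_trichotomy r 0 with hr | hr | hr
    · rw [Real.sign_of_neg hr, Real.sign_of_neg (mul_neg_of_pos_of_neg hc hr)]
    · simp [hr]
    · rw [Real.sign_of_pos hr, Real.sign_of_pos (mul_pos hc hr)]
  refine h3 _ _ (mul_pos (mul_pos (mul_pos (by positivity) (Finset.prod_pos fun i _ => hpos i)) ?_)
    (Finset.prod_pos fun j _ => pow_pos (F.rho_pos (fun _ => one_pos) j) _))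
  positivity

theorem radialSign_eq_one_or (o : FaceOrientation V) (F : SimplexFlag V p) {k : ℕ}
    (h : Fintype.card V = k + p + 1) : F.radialSign o h = 1 ∨ F.radialSign o h = -1 := by
  rw [radialSign_eq]
  exact (Real.sign_apply_eq_of_ne_zero _ (F.logForm_thetaFrame_ne_zero o o h)).symm

/-- `ψ_F` depends on the orientations only through the sign of the frame of `Θ`: a change of the
orientation of `T` changes the signs of both `ω` and the orientation of `R`. -/
theorem psi_eq_smul (o o' : FaceOrientation V) (F : SimplexFlag V p) {k : ℕ}
    (h : Fintype.card V = k + p + 1) (s : ℝ)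
    (hs : F.logForm o h (F.thetaFrame o' h) = s * F.logForm o h (F.thetaFrame o h))
    (hs' : s = 1 ∨ s = -1) : F.psi o' h = s • F.psi o h := by
  obtain ⟨c, hc, hD⟩ := dLambda_eq_smul o o' (N := k + p + 1) h
  have hform : F.logForm o' h = c • F.logForm o h := by
    rw [logForm, logForm, ← contract_smul]
    erw [hD]
  have hsign : F.radialSign o' h = c * s * F.radialSign o h := by
    rw [radialSign_eq, radialSign_eq, hform, ContinuousAlternatingMap.smul_apply, hs, smul_eq_mul,
      ← mul_assoc]
    rcases hc with rfl | rfl <;> rcases hs' with rfl | rfl <;> simp [Real.sign_neg]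
  have hcc : c * c = 1 := by rcases hc with rfl | rfl <;> norm_num
  funext x
  rw [Pi.smul_apply, psi_eq, psi_eq, hform, hsign]
  ext X
  simp only [ContinuousAlternatingMap.smul_apply,
    ContinuousAlternatingMap.compContinuousLinearMap_apply, smul_eq_mul]
  linear_combination s * F.radialSign o h * (chamberIntegral F.deg (F.rho x) *
    ∏ i, (x : V → ℝ) i) * (F.logForm o h) (⇑((scale fun i => ((x : V → ℝ) i)⁻¹).comp
      (tangentSpace V).subtypeL) ∘ X) * hcc

end SimplexFlag

/-! ### Reorienting the merged blocks -/

theorem units_smul_eq {V : Type*} [Fintype V] {k : ℕ} (u : ℤˣ) (α : SimplexForm V k) :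
    u • α = ((u : ℤ) : ℝ) • α := by
  funext x
  rw [Pi.smul_apply, Pi.smul_apply]
  ext w
  rcases Int.units_eq_one_or u with rfl | rfl
  · simp
  · change (-1 : ℤ) • α x w = _
    simp

namespace SimplexFlag

variable {V : Type*} [Fintype V] [DecidableEq V]

/-- An involution of the vertices that preserves the blocks and carries the ordering `o` of every
block to the ordering `o'` changes `ψ_F` by its sign. -/
theorem psi_of_perm {p : ℕ} (o o' : FaceOrientation V) (F : SimplexFlag V p) {k : ℕ}
    (h : Fintype.card V = k + p + 1) (τ : Equiv.Perm V) (hτ : ∀ v, τ (τ v) = v)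
    (hblk : ∀ v, F.blk (τ v) = F.blk v)
    (ho : ∀ i b, (o' (F.block i) b : V) = τ (o (F.block i) b)) :
    F.psi o' h = ((Equiv.Perm.sign τ : ℤ) : ℝ) • F.psi o h := by
  refine F.psi_eq_smul o o' h _ ?_ ?_
  · have hsingle : ∀ u : V,
        (Pi.single (τ u) 1 : V → ℝ) = fun i => (Pi.single u 1 : V → ℝ) (τ i) := by
      intro u
      funext i
      simp only [Pi.single_apply]
      exact if_congr ⟨fun hi => by rw [hi, hτ], fun hi => by rw [← hi, hτ]⟩ rfl rfl
    have hframe : ∀ a, F.thetaFrame o' h a = fun i => F.thetaFrame o h a (τ i) := by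
      intro a
      rw [thetaFrame_eq, thetaFrame_eq, head, root, ho, ho, hsingle, hsingle]
      rfl
    have hvec : ∀ j, F.blockVec j = fun i => F.blockVec j (τ i) := by
      intro j
      funext i
      rw [blockVec, blockVec, hblk]
    rw [logForm, contract_apply, contract_apply]
    refine Eq.trans (congrArg _ (funext fun a => ?_)) (dLambda_comp_perm o h τ _)
    generalize Fin.cast (Nat.add_comm k (p + 1)) a = b
    refine Fin.addCases (fun b => ?_) (fun b => ?_) b
    · simp only [Fin.append_left]
      exact hvec b
    · simp only [Fin.append_right]
      exact hframe b
  · rcases Int.units_eq_one_or (Equiv.Perm.sign τ) with hs | hs <;> simp [hs]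

/-- The orientations of the faces other than the blocks of `F` can be changed so that the forms of
the flags `F_j` change by prescribed signs: the union `V_j ∪ V_{j+1}` is a block of `F_j`, but
neither a block of `F` nor of another `F_i`. -/
theorem exists_orientation (o : FaceOrientation V) {q k : ℕ} (F : SimplexFlag V (q + 1))
    (h : Fintype.card V = k + q + 1) (s : Fin (q + 1) → ℤˣ) :
    ∃ o' : FaceOrientation V, (∀ j, o' (F.block j) = o (F.block j)) ∧
      ∀ j, (F.merge j).psi o' h = ((s j : ℤ) : ℝ) • (F.merge j).psi o h := by
  choose x hx using fun j : Fin (q + 1) => F.surj j.castSucc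
  choose y hy using fun j : Fin (q + 1) => F.surj j.succ
  have hmx : ∀ j, (F.merge j).blk (x j) = j := fun j => by
    simp [merge, hx]
  have hmy : ∀ j, (F.merge j).blk (y j) = j := fun j => by
    simp [merge, hy]
  have hxy : ∀ j, x j ≠ y j := fun j hj => by
    have := congrArg F.blk hj
    rw [hx, hy, Fin.ext_iff] at this
    simp at this
  have hmem : ∀ {p : ℕ} (G : SimplexFlag V p) (i : Fin (p + 1)) (v : V),
      v ∈ G.block i ↔ G.blk v = i := fun G i v => by simp [block]
  -- a block of `F_j` that contains both `x i` and `y i` is `V_i ∪ V_{i+1}` with `i = j`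
  have hunique : ∀ i j l, (F.merge i).block i = (F.merge j).block l → i = j ∧ l = j := by
    intro i j l hW
    have h1 := (hmem _ _ _).1 (hW ▸ (hmem _ _ _).2 (hmx i) : x i ∈ (F.merge j).block l)
    have h2 := (hmem _ _ _).1 (hW ▸ (hmem _ _ _).2 (hmy i) : y i ∈ (F.merge j).block l)
    simp only [merge, hx, hy] at h1 h2
    rw [Fin.ext_iff, val_predAbove] at h1 h2
    simp only [Fin.ext_iff, Fin.val_castSucc, Fin.val_succ] at *
    split_ifs at h1 h2 <;> omega
  have hF : ∀ i j, (F.merge i).block i ≠ F.block j := by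
    intro i j hW
    have h1 := (hmem _ _ _).1 (hW ▸ (hmem _ _ _).2 (hmx i) : x i ∈ F.block j)
    have h2 := (hmem _ _ _).1 (hW ▸ (hmem _ _ _).2 (hmy i) : y i ∈ F.block j)
    rw [hx] at h1
    rw [hy] at h2
    exact (Fin.castSucc_lt_succ (i := i)).ne (h1.trans h2.symm)
  -- `τ j` reverses the orientation of `V_j ∪ V_{j+1}` if and only if the prescribed sign is `-1`
  let τ : Fin (q + 1) → Equiv.Perm V := fun j => if s j = 1 then 1 else Equiv.swap (x j) (y j)
  have hsign : ∀ j, Equiv.Perm.sign (τ j) = s j := by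
    intro j
    rcases Int.units_eq_one_or (s j) with hs | hs
    · simp [τ, hs]
    · simp [τ, hs, Equiv.Perm.sign_swap (hxy j)]
  have hττ : ∀ j v, τ j (τ j v) = v := by
    intro j v
    simp only [τ]
    split_ifs <;> simp
  have hτblk : ∀ j v, (F.merge j).blk (τ j v) = (F.merge j).blk v := by
    intro j v
    simp only [τ]
    split_ifs with hs
    · rfl
    · rw [Equiv.swap_apply_def]
      split_ifs with h1 h2
      · rw [h1, hmx, hmy]
      · rw [h2, hmx, hmy]
      · rfl
  have hτfix : ∀ j v, (F.merge j).blk v ≠ j → τ j v = v := by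
    intro j v hv
    simp only [τ]
    split_ifs with hs
    · rfl
    · exact Equiv.swap_apply_of_ne_of_ne (fun h1 => hv (h1 ▸ hmx j)) (fun h1 => hv (h1 ▸ hmy j))
  have hex : ∀ W : Finset V, ∃ e : Fin W.card ≃ W,
      (∀ j, (F.merge j).block j = W → ∀ b, (e b : V) = τ j (o W b)) ∧
      ((∀ j, (F.merge j).block j ≠ W) → e = o W) := by
    intro W
    by_cases hW : ∃ j, (F.merge j).block j = W
    · obtain ⟨j, rfl⟩ := hW
      refine ⟨(o _).trans ((τ j).subtypePerm fun v => by rw [hmem, hmem, hτblk]),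
        fun i hi b => ?_, fun hne => absurd rfl (hne j)⟩
      rw [(hunique i j j hi).1]
      rfl
    · exact ⟨o W, fun j hj => absurd ⟨j, hj⟩ hW, fun _ => rfl⟩
  choose o' ho' ho'' using hex
  refine ⟨o', fun j => ho'' _ fun i => hF i j, fun j => ?_⟩
  rw [← hsign]
  refine (F.merge j).psi_of_perm o o' h (τ j) (hττ j) (hτblk j) fun i b => ?_
  by_cases hij : i = j
  · subst hij
    exact ho' _ i rfl b
  · rw [ho'' _ fun i' hi' => hij (hunique i' j i hi').2, hτfix]
    rw [blk_of_block]
    exact hij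

/-- The exterior derivative of `ψ_F` is a sum of the `ψ_{F_j}` with signs. -/
theorem exists_sign_d_psi (o : FaceOrientation V) {q k : ℕ} (F : SimplexFlag V (q + 1))
    (h : Fintype.card V = k + (q + 1) + 1) (h' : Fintype.card V = k + 1 + q + 1) :
    ∃ ε : Fin (q + 1) → ℤˣ,
      (F.psi o h).d = ∑ j : Fin (q + 1), ε j • (F.merge j).psi o h' := by
  have hunit : ∀ j : Fin (q + 1), ∃ u : ℤˣ, ((u : ℤ) : ℝ) * (F.merge j).radialSign o h' =
      F.radialSign o h * ((-1) ^ (q + 1) * (-1) ^ j.val) := by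
    intro j
    have hu : ∀ r : ℝ, r = 1 ∨ r = -1 → ∃ u : ℤˣ, ((u : ℤ) : ℝ) = r := by
      rintro r (rfl | rfl)
      · exact ⟨1, by simp⟩
      · exact ⟨-1, by simp⟩
    obtain ⟨u, hu1⟩ := hu _ (F.radialSign_eq_one_or o h)
    obtain ⟨v, hv1⟩ := hu _ ((F.merge j).radialSign_eq_one_or o h')
    -- signs are their own inverses
    refine ⟨u * ((-1) ^ (q + 1) * (-1) ^ j.val) * v, ?_⟩
    have hvv : ((v : ℤ) : ℝ) * ((v : ℤ) : ℝ) = 1 := by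
      rcases Int.units_eq_one_or v with rfl | rfl <;> simp
    rw [← hu1, ← hv1]
    push_cast
    linear_combination ((u : ℤ) : ℝ) * ((-1) ^ (q + 1) * (-1) ^ j.val) * hvv
  choose ε hε using hunit
  refine ⟨ε, ?_⟩
  funext x
  rw [d_psi_eq_sum o F h h' x, Finset.sum_apply]
  refine Finset.sum_congr rfl fun j _ => ?_
  rw [units_smul_eq, Pi.smul_apply, psi_eq, smul_smul, ← hε, mul_assoc]

end SimplexFlag

/-! ### The complex -/

theorem extDeriv_comp_add {E : Type*} [NormedAddCommGroup E] [NormedSpace ℝ E] {k : ℕ}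
    (f : E → E [⋀^Fin k]→L[ℝ] ℝ) (v : E) :
    extDeriv (fun w => f (v + w)) 0 = extDeriv f v := by
  rw [extDeriv, extDeriv, fderiv_comp_add_left, add_zero]

namespace SimplexForm

variable {V : Type*} [Fintype V] {k : ℕ}

theorem inChart_add (α β : SimplexForm V k) (x : V → ℝ) :
    (α + β).inChart x = α.inChart x + β.inChart x := by
  funext v
  simp only [inChart, Pi.add_apply]
  split_ifs
  · rfl
  · exact (add_zero _).symm

theorem inChart_smul (c : ℝ) (α : SimplexForm V k) (x : V → ℝ) :
    (c • α).inChart x = c • α.inChart x := by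
  funext v
  simp only [inChart, Pi.smul_apply]
  split_ifs
  · rfl
  · exact (smul_zero _).symm

theorem Smooth.add {α β : SimplexForm V k} (hα : α.Smooth) (hβ : β.Smooth) : (α + β).Smooth := by
  intro x
  rw [inChart_add]
  exact ContDiffAt.add (hα x) (hβ x)

theorem Smooth.const_smul {α : SimplexForm V k} (hα : α.Smooth) (c : ℝ) : (c • α).Smooth := by
  intro x
  rw [inChart_smul]
  exact ContDiffAt.const_smul c (hα x)

theorem smooth_zero : (0 : SimplexForm V k).Smooth := by
  intro x
  have : (0 : SimplexForm V k).inChart x = fun _ => 0 := by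
    funext v
    simp [inChart]
  rw [this]
  exact contDiffAt_const

theorem Smooth.differentiableAt {α : SimplexForm V k} (hα : α.Smooth) (x : simplexInterior V) :
    DifferentiableAt ℝ (α.inChart x) 0 :=
  (hα x).differentiableAt (by simp)

theorem d_add {α β : SimplexForm V k} (hα : α.Smooth) (hβ : β.Smooth) :
    (α + β).d = α.d + β.d := by
  funext x
  rw [Pi.add_apply, d, inChart_add]
  exact extDeriv_add (hα.differentiableAt x) (hβ.differentiableAt x)

theorem d_smul (c : ℝ) (α : SimplexForm V k) : (c • α).d = c • α.d := by
  funext x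
  rw [Pi.smul_apply, d, inChart_smul]
  exact extDeriv_smul c _

theorem d_zero : (0 : SimplexForm V k).d = 0 := by
  have := d_smul 0 (0 : SimplexForm V k)
  rwa [zero_smul, zero_smul] at this

/-- The charts at two points of the simplex differ by a translation. -/
theorem inChart_add_vector (α : SimplexForm V k) (x : V → ℝ) (v w : tangentSpace V) :
    α.inChart (x + v) w = α.inChart x (v + w) := by
  have h : x + (v : V → ℝ) + (w : V → ℝ) = x + ((v + w : tangentSpace V) : V → ℝ) := by
    rw [Submodule.coe_add, add_assoc]
  by_cases hm : x + ((v + w : tangentSpace V) : V → ℝ) ∈ simplexInterior V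
  · rw [inChart, inChart, dif_pos hm, dif_pos (h ▸ hm)]
    exact congrArg α (Subtype.ext h)
  · rw [inChart, inChart, dif_neg hm, dif_neg (h ▸ hm)]

/-- The exterior derivatives computed in the charts at all points agree with the one computed in a
single chart. -/
theorem inChart_d (α : SimplexForm V k) (x : simplexInterior V) :
    α.d.inChart x =ᶠ[nhds 0] extDeriv (α.inChart x) := by
  refine α.d.inChart_eventuallyEq x.2 fun v hv => ?_
  rw [d, funext (α.inChart_add_vector x v)]
  exact extDeriv_comp_add (α.inChart x) v

theorem Smooth.d_d {α : SimplexForm V k} (hα : α.Smooth) : α.d.d = 0 := by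
  funext x
  rw [d, (α.inChart_d x).extDeriv_eq]
  exact extDeriv_extDeriv_apply (hα x) (by simpa using ENat.LEInfty.out)

end SimplexForm

variable {V : Type*} [Fintype V] [DecidableEq V]

theorem smooth_of_mem_blowUpWhitney {o : FaceOrientation V} {k : ℕ} {α : SimplexForm V k}
    (hα : α ∈ blowUpWhitney o k) : α.Smooth := by
  induction hα using Submodule.span_induction with
  | mem α h =>
    obtain ⟨p, F, h, rfl⟩ := h
    exact F.smooth_psi o h
  | zero => exact SimplexForm.smooth_zero
  | add α β _ _ hα hβ => exact hα.add hβ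
  | smul c α _ hα => exact hα.const_smul c

theorem d_mem_blowUpWhitney {o : FaceOrientation V} {k : ℕ} {α : SimplexForm V k}
    (hα : α ∈ blowUpWhitney o k) : α.d ∈ blowUpWhitney o (k + 1) := by
  induction hα using Submodule.span_induction with
  | mem α h =>
    obtain ⟨p, F, h, rfl⟩ := h
    cases p with
    | zero =>
      rw [F.d_psi_zero o h]
      exact zero_mem _
    | succ q =>
      obtain ⟨ε, hε⟩ := F.exists_sign_d_psi o h (by omega)
      rw [hε]
      refine sum_mem fun j _ => ?_
      rw [units_smul_eq]
      exact Submodule.smul_mem _ _ (Submodule.subset_span ⟨q, F.merge j, by omega, rfl⟩)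
  | zero =>
    rw [SimplexForm.d_zero]
    exact zero_mem _
  | add α β hα' hβ' hα hβ =>
    rw [SimplexForm.d_add (smooth_of_mem_blowUpWhitney hα') (smooth_of_mem_blowUpWhitney hβ')]
    exact add_mem hα hβ
  | smul c α hα' hα =>
    rw [SimplexForm.d_smul c α]
    exact Submodule.smul_mem _ c hα

/-- The exterior derivative on the blow-up Whitney forms. -/
def blowUpWhitneyD (o : FaceOrientation V) (k : ℕ) :
    blowUpWhitney o k →ₗ[ℝ] blowUpWhitney o (k + 1) where
  toFun α := ⟨(α : SimplexForm V k).d, d_mem_blowUpWhitney α.2⟩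
  map_add' α β := Subtype.ext (SimplexForm.d_add (smooth_of_mem_blowUpWhitney α.2)
    (smooth_of_mem_blowUpWhitney β.2))
  map_smul' c α := Subtype.ext (SimplexForm.d_smul c α.1)

end

end BlowUp

theorem mainTheorem3 {V : Type*} [Fintype V] [DecidableEq V] (o : BlowUp.FaceOrientation V) :
    -- the blow-up Whitney forms are smooth on the interior of the simplex
    (∀ (p k : ℕ) (F : BlowUp.SimplexFlag V p) (h : Fintype.card V = k + p + 1),
      (F.psi o h).Smooth) ∧
    -- a flag with at least two blocks
    (∀ (q k : ℕ) (F : BlowUp.SimplexFlag V (q + 1)) (h : Fintype.card V = k + (q + 1) + 1),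
      -- for the given orientations, one sign for each term
      (∃ ε : Fin (q + 1) → ℤˣ,
        (F.psi o h).d = ∑ j : Fin (q + 1), ε j • (F.merge j).psi o (k := k + 1) (by omega)) ∧
      -- all signs are `+` if the merged blocks are suitably oriented
      (∃ o' : BlowUp.FaceOrientation V, (∀ j, o' (F.block j) = o (F.block j)) ∧
        (F.psi o h).d = ∑ j : Fin (q + 1), (F.merge j).psi o' (k := k + 1) (by omega))) ∧
    -- the flag with a single block: the sum is empty
    (∀ (k : ℕ) (F : BlowUp.SimplexFlag V 0) (h : Fintype.card V = k + 0 + 1),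
      (F.psi o h).d = 0) ∧
    -- the blow-up Whitney forms are a complex under the exterior derivative
    (∃ D : ∀ k : ℕ, BlowUp.blowUpWhitney o k →ₗ[ℝ] BlowUp.blowUpWhitney o (k + 1),
      (∀ (k : ℕ) (ψ : BlowUp.blowUpWhitney o k),
        ((D k ψ : BlowUp.blowUpWhitney o (k + 1)) : BlowUp.SimplexForm V (k + 1)) =
          BlowUp.SimplexForm.d (ψ : BlowUp.SimplexForm V k)) ∧
      ∀ k : ℕ, D (k + 1) ∘ₗ D k = 0) := by
  refine ⟨fun p k F h => F.smooth_psi o h, fun q k F h => ?_, fun k F h => F.d_psi_zero o h,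
    BlowUp.blowUpWhitneyD o, fun k ψ => rfl, fun k => LinearMap.ext fun ψ =>
      Subtype.ext (BlowUp.smooth_of_mem_blowUpWhitney ψ.2).d_d⟩
  have h' : Fintype.card V = k + 1 + q + 1 := by omega
  obtain ⟨ε, hε⟩ := F.exists_sign_d_psi o h h'
  obtain ⟨o', ho', hψ⟩ := F.exists_orientation o h' ε
  refine ⟨⟨ε, hε⟩, o', ho', hε.trans (Finset.sum_congr rfl fun j _ => ?_)⟩
  rw [hψ, BlowUp.units_smul_eq]
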